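/- Let $H$ be a probability distribution on $\mathbb{R}^2$ with finite second moment and non-degenerate marginals (neither coordinate is almost surely constant), and let $(X,Y)\sim H$. With $\|\cdot\|$ the Euclidean norm and $0/0:=0$, let $$(R_1(z),R_2(z))=\mathbb{E}\,\frac{z-(X,Y)}{\|z-(X,Y)\|},\qquad z\in\mathbb{R}^2,$$ be the spatial rank function of $H$, and put $$T_1(H)=2\,\mathbb{E}[X R_1(X,Y)],\quad T_2(H)=2\,\mathbb{E}[X R_2(X,Y)],\quad T_3(H)=2\,\mathbb{E}[Y R_2(X,Y)],\quad \rho_g(H)=\frac{T_2(H)}{\sqrt{T_1(H)}\sqrt{T_3(H)}} .$$ For a functional $T$ of distributions, let $$\mathrm{IF}(z;T,H)=\lim_{\varepsilon\downarrow0}\frac{T((1-\varepsilon)H+\varepsilon\delta_z)-T(H)}{\varepsilon}$$ be its influence function at $H$, and write $L_i(x,y)=\mathrm{IF}((x,y);T_i,H)$, $T_i=T_i(H)$, $\rho_g=\rho_g(H)$. For i.i.d. $z_1,z_2,\dots\sim H$, $z_i=(x_i,y_i)$, define the sample symmetric Gini correlation $$\hat\rho_g=\frac{\sum_{1\le i<j\le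 n}\frac{(x_i-x_j)(y_i-y_j)}{\|z_i-z_j\|}}{\sqrt{\sum_{1\le i<j\le n}\frac{(x_i-x_j)^2}{\|z_i-z_j\|}}\sqrt{\sum_{1\le i<j\le n}\frac{(y_i-y_j)^2}{\|z_i-z_j\|}}}$$ (with value $0$ if the denominator vanishes). Then $\hat\rho_g$ is an asymptotically unbiased ($\mathbb{E}\hat\rho_g\to\rho_g$ as $n\to\infty$) and $\sqrt n$-consistent ($\sqrt n(\hat\rho_g-\rho_g)$ is bounded in probability) estimator of $\rho_g$. Furthermore, $T_1,T_3>0$, the influence functions of $T_1,T_2,T_3,\rho_g$ at $H$ exist at every point and are square integrable with respect to $H$, and $$\sqrt n\,(\hat\rho_g-\rho_g)\xrightarrow{d}N(0,v_g)\quad\text{as } n\to\infty,\qquad v_g=\mathbb{E}\big[\mathrm{IF}((X,Y);\rho_g,H)^2\big],$$ where $N(0,0)$ is the point mass at $0$. If $T_2\neq0$, then $$v_g=\frac{\rho_g^2}{4}\Big(\frac{\mathbb{E}[L_1^2]}{T_1^2}+\frac{4\,\mathbb{E}[L_2^2]}{T_2^2}+\frac{\mathbb{E}[L_3^2]}{T_3^2}-\frac{4\,\mathbb{E}[L_1L_2]}{T_1T_2}+\frac{2\,\mathbb{E}[L_1L_3]}{T_1T_3}-\frac{4\,\mathbb{E}[L_2L_3]}{T_2T_3}\Big),\qquad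 L_i=L_i(X,Y),$$ and if $T_2=0$ (equivalently $\rho_g=0$), then $v_g=\mathbb{E}[L_2^2]/(T_1T_3)$. -/

import Mathlib

open MeasureTheory ProbabilityTheory Filter Topology

noncomputable section

/-- The Euclidean norm of a point `z = (x, y)` of the plane (the norm that `ℝ × ℝ` carries
in Mathlib is the sup norm, so the Euclidean norm is written out). -/
def euclNorm (z : ℝ × ℝ) : ℝ := Real.sqrt (z.1 ^ 2 + z.2 ^ 2)

/-- The spatial sign `s(z) = z / ‖z‖`, with `s(0) = 0`. -/
def spatialSign (z : ℝ × ℝ) : ℝ × ℝ := (z.1 / euclNorm z, z.2 / euclNorm z)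

/-- First component of the spatial rank function, `R₁(z) = E (x - X) / ‖z - Z‖`, `Z ∼ H`. -/
def spatialRank₁ (H : Measure (ℝ × ℝ)) (z : ℝ × ℝ) : ℝ := ∫ w, (spatialSign (z - w)).1 ∂H

/-- Second component of the spatial rank function, `R₂(z) = E (y - Y) / ‖z - Z‖`, `Z ∼ H`. -/
def spatialRank₂ (H : Measure (ℝ × ℝ)) (z : ℝ × ℝ) : ℝ := ∫ w, (spatialSign (z - w)).2 ∂H

/-- `T₁(H) = cov_g(X, X) = 2 E X R₁(Z)`. -/
def giniT₁ (H : Measure (ℝ × ℝ)) : ℝ := 2 * ∫ z, z.1 * spatialRank₁ H z ∂H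

/-- `T₂(H) = cov_g(X, Y) = 2 E X R₂(Z)`. -/
def giniT₂ (H : Measure (ℝ × ℝ)) : ℝ := 2 * ∫ z, z.1 * spatialRank₂ H z ∂H

/-- `T₃(H) = cov_g(Y, Y) = 2 E Y R₂(Z)`. -/
def giniT₃ (H : Measure (ℝ × ℝ)) : ℝ := 2 * ∫ z, z.2 * spatialRank₂ H z ∂H

/-- The symmetric Gini correlation `ρ_g = T₂ / (√T₁ √T₃)`, as a functional of the law `H`. -/
def giniCorr (H : Measure (ℝ × ℝ)) : ℝ :=
  giniT₂ H / (Real.sqrt (giniT₁ H) * Real.sqrt (giniT₃ H))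

/-- The contaminated distribution `(1 - ε) H + ε δ_z` (used for `0 < ε < 1`). -/
def contaminate (H : Measure (ℝ × ℝ)) (z : ℝ × ℝ) (ε : ℝ) : Measure (ℝ × ℝ) :=
  ENNReal.ofReal (1 - ε) • H + ENNReal.ofReal ε • Measure.dirac z

/-- The difference quotient `(T((1 - ε) H + ε δ_z) - T(H)) / ε`. -/
def influenceQuotient (T : Measure (ℝ × ℝ) → ℝ) (H : Measure (ℝ × ℝ)) (z : ℝ × ℝ) (ε : ℝ) : ℝ :=
  (T (contaminate H z ε) - T H) / ε

/-- The influence function of the functional `T` at `H`: the limit of the difference quotients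
as `ε ↓ 0`. -/
def influenceFunction (T : Measure (ℝ × ℝ) → ℝ) (H : Measure (ℝ × ℝ)) (z : ℝ × ℝ) : ℝ :=
  limUnder (𝓝[>] (0 : ℝ)) (influenceQuotient T H z)

/-- The influence function of `T` at `H` exists: the defining limit exists at every point. -/
def HasInfluenceFunction (T : Measure (ℝ × ℝ) → ℝ) (H : Measure (ℝ × ℝ)) : Prop :=
  ∀ z : ℝ × ℝ, ∃ l : ℝ, Tendsto (influenceQuotient T H z) (𝓝[>] 0) (𝓝 l)

/-- `L₁`, the influence function of `T₁`. -/
def giniL₁ (H : Measure (ℝ × ℝ)) : ℝ × ℝ → ℝ := influenceFunction giniT₁ H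

/-- `L₂`, the influence function of `T₂`. -/
def giniL₂ (H : Measure (ℝ × ℝ)) : ℝ × ℝ → ℝ := influenceFunction giniT₂ H

/-- `L₃`, the influence function of `T₃`. -/
def giniL₃ (H : Measure (ℝ × ℝ)) : ℝ × ℝ → ℝ := influenceFunction giniT₃ H

/-- The asymptotic variance `v_g = E [IF((X, Y); ρ_g, H)²]`. -/
def giniAsympVar (H : Measure (ℝ × ℝ)) : ℝ := ∫ z, (influenceFunction giniCorr H z) ^ 2 ∂H

/-- The sum over all pairs `i < j` of indices among the first `n`. -/
def pairSum (k : ℝ × ℝ → ℝ) (n : ℕ) (z : ℕ → ℝ × ℝ) : ℝ :=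
  ∑ j ∈ Finset.range n, ∑ i ∈ Finset.range j, k (z i - z j)

/-- The sample symmetric Gini correlation of the sample `z 0, …, z (n - 1)`. -/
def sampleGiniCorr (n : ℕ) (z : ℕ → ℝ × ℝ) : ℝ :=
  pairSum (fun d ↦ d.1 * d.2 / euclNorm d) n z /
    (Real.sqrt (pairSum (fun d ↦ d.1 ^ 2 / euclNorm d) n z) *
      Real.sqrt (pairSum (fun d ↦ d.2 ^ 2 / euclNorm d) n z))

/-- `√n`-consistency of a sequence of estimators `est n` of `θ`: the sequence
`√n (est n - θ)` is bounded in probability. -/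
def IsRootNConsistent {Ω : Type*} [MeasurableSpace Ω] (P : Measure Ω) (est : ℕ → Ω → ℝ)
    (θ : ℝ) : Prop :=
  ∀ ε : ℝ, 0 < ε → ∃ M : ℝ, ∀ n : ℕ,
    P {ω | M < Real.sqrt n * |est n ω - θ|} ≤ ENNReal.ofReal ε

end

/-!
Each of `T₁, T₂, T₃` is a kernel mean `E k(Z - Z')` of two independent copies of the law, by
symmetrization (`two_mul_integral_mul_integral_sub`), with an even kernel `k` of linear growth.
Hence everything reduces to facts about one general kernel.

A kernel mean is quadratic in the law, so along the contamination path it is a polynomial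
(`kernelMean_contaminate`) and its influence function is `2 (E k(z - Z) - E k(Z - Z'))`. It is
square integrable because `k` has linear growth. The influence function of `ρ_g` follows by the
chain rule for `(u₁, u₂, u₃) ↦ u₂ / (√u₁ √u₃)` at `(T₁, T₂, T₃)`, where `T₁, T₃ > 0` by
non-degeneracy.

The sample correlation is the same function of the pair averages of the three kernels. By
Hoeffding's decomposition, the scaled error of a pair average is the normalized sum of the
influence function over the sample plus a degenerate U-statistic, whose terms are pairwise
orthogonal and which therefore vanishes in `L²` (`IsPairKernel.tendstoInMeasure_hajek`). The
central limit theorem then makes every pair average asymptotically normal. This is used twice: for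
the three Gini kernels, where it gives the boundedness in probability that the delta method
(`tendstoInMeasure_delta_remainder`) needs, and for `corrKernel`, the linear combination of the
three whose coefficients are the partial derivatives of the correlation. The delta method says
that the scaled error of the sample correlation is asymptotically that of the pair average of
`corrKernel`, whose influence function is that of `ρ_g`. In this way no multivariate limit theorem
is needed.

Root-n consistency is tightness of a weakly convergent sequence. Asymptotic unbiasedness follows
by bounded convergence, since the sample correlation is at most `1` in absolute value by
Cauchy–Schwarz. The two variance formulas come from expanding the square of the influence function
of `ρ_g`.
-/

/-! ### Kernels on the plane, their double integrals and their projections -/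

/-- A kernel `k` on the plane that is evaluated at the difference of two sample points: measurable,
even, and of at most linear growth. The norm is the sup norm of `ℝ × ℝ`, which is as good as the
Euclidean one up to the constant. -/
structure IsPairKernel (k : ℝ × ℝ → ℝ) : Prop where
  measurable : Measurable k
  neg : ∀ d, k (-d) = k d
  bound : ∃ C, 0 ≤ C ∧ ∀ d, |k d| ≤ C * ‖d‖

/-- The mean `E k(Z - Z')` for independent `Z, Z' ∼ H`. -/
noncomputable def kernelMean (k : ℝ × ℝ → ℝ) (H : Measure (ℝ × ℝ)) : ℝ :=
  ∫ z, ∫ w, k (z - w) ∂H ∂H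

/-- The conditional mean `z ↦ E k(z - Z)` for `Z ∼ H`. -/
noncomputable def kernelProj (k : ℝ × ℝ → ℝ) (H : Measure (ℝ × ℝ)) (z : ℝ × ℝ) : ℝ :=
  ∫ w, k (z - w) ∂H

namespace IsPairKernel

variable {k l : ℝ × ℝ → ℝ} {H : Measure (ℝ × ℝ)}

lemma map_zero (hk : IsPairKernel k) : k 0 = 0 := by
  obtain ⟨C, -, hC⟩ := hk.bound
  simpa using hC 0

lemma add (hk : IsPairKernel k) (hl : IsPairKernel l) : IsPairKernel (fun d ↦ k d + l d) where
  measurable := hk.measurable.add hl.measurable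
  neg d := by simp only [hk.neg, hl.neg]
  bound := by
    obtain ⟨C, hC0, hC⟩ := hk.bound
    obtain ⟨D, hD0, hD⟩ := hl.bound
    refine ⟨C + D, by positivity, fun d ↦ (abs_add_le _ _).trans ?_⟩
    rw [add_mul]
    exact add_le_add (hC d) (hD d)

lemma const_mul (hk : IsPairKernel k) (a : ℝ) : IsPairKernel (fun d ↦ a * k d) where
  measurable := hk.measurable.const_mul a
  neg d := by simp only [hk.neg]
  bound := by
    obtain ⟨C, hC0, hC⟩ := hk.bound
    refine ⟨|a| * C, by positivity, fun d ↦ ?_⟩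
    rw [abs_mul, mul_assoc]
    exact mul_le_mul_of_nonneg_left (hC d) (abs_nonneg a)

lemma sub_comm (hk : IsPairKernel k) (z w : ℝ × ℝ) : k (z - w) = k (w - z) := by
  rw [← hk.neg, neg_sub]

lemma measurable_sub (hk : IsPairKernel k) :
    Measurable (fun p : (ℝ × ℝ) × (ℝ × ℝ) ↦ k (p.1 - p.2)) :=
  hk.measurable.comp (measurable_fst.sub measurable_snd)

lemma exists_bound_sub (hk : IsPairKernel k) :
    ∃ C, 0 ≤ C ∧ ∀ z w, |k (z - w)| ≤ C * (‖z‖ + ‖w‖) := by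
  obtain ⟨C, hC0, hC⟩ := hk.bound
  exact ⟨C, hC0, fun z w ↦ (hC _).trans (mul_le_mul_of_nonneg_left (norm_sub_le z w) hC0)⟩

lemma memLp_sub (hk : IsPairKernel k) [IsFiniteMeasure H] {p : ENNReal}
    (hH : MemLp (fun z : ℝ × ℝ ↦ z) p H) :
    MemLp (fun q : (ℝ × ℝ) × (ℝ × ℝ) ↦ k (q.1 - q.2)) p (H.prod H) := by
  obtain ⟨C, hC0, hC⟩ := hk.exists_bound_sub
  refine MemLp.of_le (((hH.norm.comp_fst H).add (hH.norm.comp_snd H)).const_mul C)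
    hk.measurable_sub.aestronglyMeasurable (ae_of_all _ fun q ↦ ?_)
  rw [Real.norm_eq_abs]
  exact (hC q.1 q.2).trans (le_abs_self _)

lemma integrable_sub (hk : IsPairKernel k) [IsFiniteMeasure H]
    (hH : Integrable (fun z : ℝ × ℝ ↦ z) H) :
    Integrable (fun q : (ℝ × ℝ) × (ℝ × ℝ) ↦ k (q.1 - q.2)) (H.prod H) :=
  memLp_one_iff_integrable.1 (hk.memLp_sub (memLp_one_iff_integrable.2 hH))

lemma integrable_sub_left (hk : IsPairKernel k) [IsFiniteMeasure H]
    (hH : Integrable (fun z : ℝ × ℝ ↦ z) H) (z : ℝ × ℝ) :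
    Integrable (fun w ↦ k (z - w)) H := by
  obtain ⟨C, hC0, hC⟩ := hk.exists_bound_sub
  refine Integrable.mono' (((integrable_const ‖z‖).add hH.norm).const_mul C)
    (hk.measurable.comp (measurable_const.sub measurable_id)).aestronglyMeasurable
    (ae_of_all _ fun w ↦ hC z w)

lemma measurable_proj (hk : IsPairKernel k) [SFinite H] : Measurable (kernelProj k H) :=
  (hk.measurable_sub.stronglyMeasurable.integral_prod_right (ν := H)).measurable

lemma memLp_proj (hk : IsPairKernel k) [IsFiniteMeasure H] {p : ENNReal}
    (hH : MemLp (fun z : ℝ × ℝ ↦ z) p H) (hH1 : Integrable (fun z : ℝ × ℝ ↦ z) H) :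
    MemLp (kernelProj k H) p H := by
  obtain ⟨C, hC0, hC⟩ := hk.exists_bound_sub
  refine MemLp.of_le (((hH.norm.mul_const (H.real Set.univ)).add
    (memLp_const (∫ w, ‖w‖ ∂H))).const_mul C)
    hk.measurable_proj.aestronglyMeasurable (ae_of_all _ fun z ↦ ?_)
  have h : ‖kernelProj k H z‖ ≤ ∫ w, C * (‖z‖ + ‖w‖) ∂H :=
    norm_integral_le_of_norm_le (((integrable_const ‖z‖).add hH1.norm).const_mul C)
      (ae_of_all _ fun w ↦ hC z w)
  refine h.trans ((le_of_eq ?_).trans (le_abs_self _))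
  rw [integral_const_mul, integral_add (integrable_const _) hH1.norm]
  simp [mul_comm]

lemma integrable_proj (hk : IsPairKernel k) [IsFiniteMeasure H]
    (hH : Integrable (fun z : ℝ × ℝ ↦ z) H) : Integrable (kernelProj k H) H :=
  (hk.integrable_sub hH).integral_prod_left

lemma kernelProj_add (hk : IsPairKernel k) (hl : IsPairKernel l) [IsFiniteMeasure H]
    (hH : Integrable (fun z : ℝ × ℝ ↦ z) H) (z : ℝ × ℝ) :
    kernelProj (fun d ↦ k d + l d) H z = kernelProj k H z + kernelProj l H z :=
  integral_add (hk.integrable_sub_left hH z) (hl.integrable_sub_left hH z)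

lemma kernelMean_add (hk : IsPairKernel k) (hl : IsPairKernel l) [IsFiniteMeasure H]
    (hH : Integrable (fun z : ℝ × ℝ ↦ z) H) :
    kernelMean (fun d ↦ k d + l d) H = kernelMean k H + kernelMean l H := by
  change ∫ z, kernelProj (fun d ↦ k d + l d) H z ∂H = _
  simp_rw [hk.kernelProj_add hl hH]
  exact integral_add (hk.integrable_proj hH) (hl.integrable_proj hH)

end IsPairKernel

lemma kernelProj_const_mul (k : ℝ × ℝ → ℝ) (a : ℝ) (H : Measure (ℝ × ℝ)) (z : ℝ × ℝ) :
    kernelProj (fun d ↦ a * k d) H z = a * kernelProj k H z :=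
  integral_const_mul _ _

lemma kernelMean_const_mul (k : ℝ × ℝ → ℝ) (a : ℝ) (H : Measure (ℝ × ℝ)) :
    kernelMean (fun d ↦ a * k d) H = a * kernelMean k H := by
  simp only [kernelMean, integral_const_mul]

/-- A kernel mean is a quadratic functional of the law, so it is a quadratic polynomial along the
contamination path; the `ε ^ 2` term is missing because `k 0 = 0`. -/
lemma kernelMean_contaminate {k : ℝ × ℝ → ℝ} (hk : IsPairKernel k) {H : Measure (ℝ × ℝ)}
    [IsFiniteMeasure H] (hH : Integrable (fun z : ℝ × ℝ ↦ z) H) (z : ℝ × ℝ) {ε : ℝ}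
    (h0 : 0 ≤ ε) (h1 : ε ≤ 1) :
    kernelMean k (contaminate H z ε) =
      (1 - ε) ^ 2 * kernelMean k H + 2 * ε * (1 - ε) * kernelProj k H z := by
  have hmix {f : ℝ × ℝ → ℝ} (hf : Integrable f H) :
      ∫ w, f w ∂(contaminate H z ε) = (1 - ε) * ∫ w, f w ∂H + ε * f z := by
    have hd : Integrable f (Measure.dirac z) := integrable_dirac (by simp)
    rw [contaminate, integral_add_measure (hf.smul_measure ENNReal.ofReal_ne_top)
      (hd.smul_measure ENNReal.ofReal_ne_top), integral_smul_measure, integral_smul_measure,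
      integral_dirac, ENNReal.toReal_ofReal (by linarith), ENNReal.toReal_ofReal h0,
      smul_eq_mul, smul_eq_mul]
  have hinner (x : ℝ × ℝ) : ∫ w, k (x - w) ∂(contaminate H z ε) =
      (1 - ε) * kernelProj k H x + ε * k (z - x) := by
    rw [hmix (hk.integrable_sub_left hH x), hk.sub_comm x z, kernelProj]
  simp only [kernelMean, hinner]
  have hi : Integrable (fun x ↦ (1 - ε) * kernelProj k H x) H := (hk.integrable_proj hH).const_mul _
  have hi' : Integrable (fun x ↦ ε * k (z - x)) H := (hk.integrable_sub_left hH z).const_mul _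
  have hmix' := hmix (hi.add hi')
  simp only [Pi.add_apply] at hmix'
  rw [hmix', integral_add hi hi', integral_const_mul, integral_const_mul, sub_self,
    hk.map_zero]
  simp only [kernelProj]
  ring

lemma isFiniteMeasure_contaminate (H : Measure (ℝ × ℝ)) [IsFiniteMeasure H] (z : ℝ × ℝ) (ε : ℝ) :
    IsFiniteMeasure (contaminate H z ε) := by
  have := Measure.smul_finite H (c := ENNReal.ofReal (1 - ε)) ENNReal.ofReal_ne_top
  have := Measure.smul_finite (Measure.dirac z) (c := ENNReal.ofReal ε) ENNReal.ofReal_ne_top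
  unfold contaminate
  infer_instance

lemma integrable_id_contaminate {H : Measure (ℝ × ℝ)} (hH : Integrable (fun z : ℝ × ℝ ↦ z) H)
    (z : ℝ × ℝ) (ε : ℝ) : Integrable (fun z : ℝ × ℝ ↦ z) (contaminate H z ε) :=
  (hH.smul_measure ENNReal.ofReal_ne_top).add_measure
    ((integrable_dirac (by simp)).smul_measure ENNReal.ofReal_ne_top)

/-! ### The three Gini kernels -/

/-- The kernel `x² / ‖(x, y)‖` of `T₁`. -/
noncomputable def giniKernel₁ (d : ℝ × ℝ) : ℝ := d.1 ^ 2 / euclNorm d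

/-- The kernel `x y / ‖(x, y)‖` of `T₂`. -/
noncomputable def giniKernel₂ (d : ℝ × ℝ) : ℝ := d.1 * d.2 / euclNorm d

/-- The kernel `y² / ‖(x, y)‖` of `T₃`. -/
noncomputable def giniKernel₃ (d : ℝ × ℝ) : ℝ := d.2 ^ 2 / euclNorm d

lemma euclNorm_nonneg (d : ℝ × ℝ) : 0 ≤ euclNorm d := Real.sqrt_nonneg _

lemma euclNorm_neg (d : ℝ × ℝ) : euclNorm (-d) = euclNorm d := by simp [euclNorm]

lemma measurable_euclNorm : Measurable euclNorm := by unfold euclNorm; fun_prop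

lemma abs_fst_le_euclNorm (d : ℝ × ℝ) : |d.1| ≤ euclNorm d :=
  Real.abs_le_sqrt (by nlinarith [sq_nonneg d.2])

lemma abs_snd_le_euclNorm (d : ℝ × ℝ) : |d.2| ≤ euclNorm d :=
  Real.abs_le_sqrt (by nlinarith [sq_nonneg d.1])

lemma abs_spatialSign_fst_le (d : ℝ × ℝ) : |(spatialSign d).1| ≤ 1 := by
  rw [spatialSign, abs_div, abs_of_nonneg (euclNorm_nonneg d)]
  exact div_le_one_of_le₀ (abs_fst_le_euclNorm d) (euclNorm_nonneg d)

lemma abs_spatialSign_snd_le (d : ℝ × ℝ) : |(spatialSign d).2| ≤ 1 := by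
  rw [spatialSign, abs_div, abs_of_nonneg (euclNorm_nonneg d)]
  exact div_le_one_of_le₀ (abs_snd_le_euclNorm d) (euclNorm_nonneg d)

lemma spatialSign_neg (d : ℝ × ℝ) : spatialSign (-d) = -spatialSign d := by
  simp [spatialSign, euclNorm_neg, neg_div]

lemma measurable_spatialSign : Measurable spatialSign :=
  (measurable_fst.div measurable_euclNorm).prodMk (measurable_snd.div measurable_euclNorm)

lemma giniKernel₁_eq (d : ℝ × ℝ) : giniKernel₁ d = d.1 * (spatialSign d).1 := by
  simp only [giniKernel₁, spatialSign]; ring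

lemma giniKernel₂_eq (d : ℝ × ℝ) : giniKernel₂ d = d.1 * (spatialSign d).2 := by
  simp only [giniKernel₂, spatialSign]; ring

lemma giniKernel₃_eq (d : ℝ × ℝ) : giniKernel₃ d = d.2 * (spatialSign d).2 := by
  simp only [giniKernel₃, spatialSign]; ring

/-- An odd function of linear growth times an odd function bounded by `1` is a kernel. -/
lemma isPairKernel_mul {f s : ℝ × ℝ → ℝ} (hf : Measurable f) (hs : Measurable s)
    (hf' : ∀ d, f (-d) = -f d) (hs' : ∀ d, s (-d) = -s d) (hfb : ∀ d, |f d| ≤ ‖d‖)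
    (hsb : ∀ d, |s d| ≤ 1) : IsPairKernel (fun d ↦ f d * s d) where
  measurable := hf.mul hs
  neg d := by rw [hf', hs', neg_mul_neg]
  bound := ⟨1, zero_le_one, fun d ↦ by
    rw [abs_mul, mul_comm]
    exact mul_le_mul (hsb d) (hfb d) (abs_nonneg _) zero_le_one⟩

lemma isPairKernel_giniKernel₁ : IsPairKernel giniKernel₁ := by
  rw [funext giniKernel₁_eq]
  exact isPairKernel_mul measurable_fst measurable_spatialSign.fst (fun _ ↦ rfl)
    (fun d ↦ by rw [spatialSign_neg]; rfl) norm_fst_le abs_spatialSign_fst_le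

lemma isPairKernel_giniKernel₂ : IsPairKernel giniKernel₂ := by
  rw [funext giniKernel₂_eq]
  exact isPairKernel_mul measurable_fst measurable_spatialSign.snd (fun _ ↦ rfl)
    (fun d ↦ by rw [spatialSign_neg]; rfl) norm_fst_le abs_spatialSign_snd_le

lemma isPairKernel_giniKernel₃ : IsPairKernel giniKernel₃ := by
  rw [funext giniKernel₃_eq]
  exact isPairKernel_mul measurable_snd measurable_spatialSign.snd (fun _ ↦ rfl)
    (fun d ↦ by rw [spatialSign_neg]; rfl) norm_snd_le abs_spatialSign_snd_le

/-- Symmetrization: exchanging the two independent copies turns `2 E f(Z) s(Z - Z')`, with `s` odd,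
into `E (f(Z) - f(Z')) s(Z - Z')`. -/
lemma two_mul_integral_mul_integral_sub {H : Measure (ℝ × ℝ)} [IsFiniteMeasure H]
    {f s : ℝ × ℝ → ℝ} (hf : Integrable f H) (hs : Measurable s) (hsb : ∀ d, |s d| ≤ 1)
    (hs' : ∀ d, s (-d) = -s d) :
    2 * ∫ z, f z * ∫ w, s (z - w) ∂H ∂H = ∫ z, ∫ w, (f z - f w) * s (z - w) ∂H ∂H := by
  have hsm : Measurable (fun p : (ℝ × ℝ) × (ℝ × ℝ) ↦ s (p.1 - p.2)) :=
    hs.comp (measurable_fst.sub measurable_snd)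
  have h1 : Integrable (fun p : (ℝ × ℝ) × (ℝ × ℝ) ↦ f p.1 * s (p.1 - p.2)) (H.prod H) :=
    (hf.comp_fst H).mul_bdd (c := 1) hsm.aestronglyMeasurable (ae_of_all _ fun p ↦ hsb _)
  have h2 : Integrable (fun p : (ℝ × ℝ) × (ℝ × ℝ) ↦ f p.2 * s (p.1 - p.2)) (H.prod H) :=
    (hf.comp_snd H).mul_bdd (c := 1) hsm.aestronglyMeasurable (ae_of_all _ fun p ↦ hsb _)
  have e1 : ∫ z, f z * ∫ w, s (z - w) ∂H ∂H = ∫ p, f p.1 * s (p.1 - p.2) ∂(H.prod H) := by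
    rw [integral_prod _ h1]
    simp only [integral_const_mul]
  have e2 : ∫ p, f p.2 * s (p.1 - p.2) ∂(H.prod H) = -∫ p, f p.1 * s (p.1 - p.2) ∂(H.prod H) := by
    rw [← integral_prod_swap, ← integral_neg]
    refine integral_congr_ae (ae_of_all _ fun p ↦ ?_)
    simp only [Prod.fst_swap, Prod.snd_swap]
    rw [← neg_sub p.1 p.2, hs']
    ring
  have e3 : ∫ z, ∫ w, (f z - f w) * s (z - w) ∂H ∂H =
      ∫ p, (f p.1 * s (p.1 - p.2) - f p.2 * s (p.1 - p.2)) ∂(H.prod H) := by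
    have h3 := integral_prod _ (h1.sub h2)
    simp only [Pi.sub_apply] at h3
    rw [h3]
    simp only [sub_mul]
  rw [e3, integral_sub h1 h2, e2, e1]
  ring

section GiniMean

variable {H : Measure (ℝ × ℝ)} [IsFiniteMeasure H]

lemma giniT₁_eq_kernelMean (hH : Integrable (fun z : ℝ × ℝ ↦ z) H) :
    giniT₁ H = kernelMean giniKernel₁ H := by
  simp only [giniT₁, spatialRank₁]
  rw [two_mul_integral_mul_integral_sub (s := fun d ↦ (spatialSign d).1) hH.fst
    measurable_spatialSign.fst abs_spatialSign_fst_le (fun d ↦ by rw [spatialSign_neg]; rfl)]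
  simp only [kernelMean, giniKernel₁_eq, Prod.fst_sub]

lemma giniT₂_eq_kernelMean (hH : Integrable (fun z : ℝ × ℝ ↦ z) H) :
    giniT₂ H = kernelMean giniKernel₂ H := by
  simp only [giniT₂, spatialRank₂]
  rw [two_mul_integral_mul_integral_sub (s := fun d ↦ (spatialSign d).2) hH.fst
    measurable_spatialSign.snd abs_spatialSign_snd_le (fun d ↦ by rw [spatialSign_neg]; rfl)]
  simp only [kernelMean, giniKernel₂_eq, Prod.fst_sub]

lemma giniT₃_eq_kernelMean (hH : Integrable (fun z : ℝ × ℝ ↦ z) H) :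
    giniT₃ H = kernelMean giniKernel₃ H := by
  simp only [giniT₃, spatialRank₂]
  rw [two_mul_integral_mul_integral_sub (s := fun d ↦ (spatialSign d).2) hH.snd
    measurable_spatialSign.snd abs_spatialSign_snd_le (fun d ↦ by rw [spatialSign_neg]; rfl)]
  simp only [kernelMean, giniKernel₃_eq, Prod.snd_sub]

/-- A nonnegative kernel that vanishes at `z - w` only if `f w = f z` has positive mean unless `f`
is almost surely constant. -/
lemma kernelMean_pos {k f : ℝ × ℝ → ℝ} [NeZero H] (hk : IsPairKernel k)
    (hH : Integrable (fun z : ℝ × ℝ ↦ z) H) (hk0 : ∀ d, 0 ≤ k d)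
    (hkf : ∀ z w, k (z - w) = 0 → f w = f z) (hf : ∀ c, ¬ ∀ᵐ z ∂H, f z = c) :
    0 < kernelMean k H := by
  refine lt_of_le_of_ne (integral_nonneg fun z ↦ integral_nonneg fun w ↦ hk0 _) fun h0 ↦ ?_
  have hz : ∀ᵐ z ∂H, kernelProj k H z = 0 :=
    (integral_eq_zero_iff_of_nonneg (fun z ↦ integral_nonneg fun w ↦ hk0 _)
      (hk.integrable_proj hH)).1 h0.symm
  obtain ⟨z, hz⟩ := hz.exists
  have hw : ∀ᵐ w ∂H, k (z - w) = 0 :=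
    (integral_eq_zero_iff_of_nonneg (fun w ↦ hk0 _) (hk.integrable_sub_left hH z)).1 hz
  exact hf (f z) (hw.mono fun w hw ↦ hkf z w hw)

lemma giniKernel₁_nonneg (d : ℝ × ℝ) : 0 ≤ giniKernel₁ d :=
  div_nonneg (sq_nonneg _) (euclNorm_nonneg d)

lemma giniKernel₃_nonneg (d : ℝ × ℝ) : 0 ≤ giniKernel₃ d :=
  div_nonneg (sq_nonneg _) (euclNorm_nonneg d)

lemma fst_eq_zero_of_giniKernel₁_eq_zero {d : ℝ × ℝ} (h : giniKernel₁ d = 0) : d.1 = 0 := by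
  rcases div_eq_zero_iff.1 h with h | h
  · exact pow_eq_zero_iff two_ne_zero |>.1 h
  · exact abs_nonpos_iff.1 ((abs_fst_le_euclNorm d).trans h.le)

lemma snd_eq_zero_of_giniKernel₃_eq_zero {d : ℝ × ℝ} (h : giniKernel₃ d = 0) : d.2 = 0 := by
  rcases div_eq_zero_iff.1 h with h | h
  · exact pow_eq_zero_iff two_ne_zero |>.1 h
  · exact abs_nonpos_iff.1 ((abs_snd_le_euclNorm d).trans h.le)

lemma giniT₁_pos [NeZero H] (hH : Integrable (fun z : ℝ × ℝ ↦ z) H)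
    (hX : ∀ c : ℝ, ¬ ∀ᵐ z ∂H, z.1 = c) : 0 < giniT₁ H := by
  rw [giniT₁_eq_kernelMean hH]
  exact kernelMean_pos (f := Prod.fst) isPairKernel_giniKernel₁ hH giniKernel₁_nonneg
    (fun z w h ↦ (sub_eq_zero.1 (fst_eq_zero_of_giniKernel₁_eq_zero h)).symm) hX

lemma giniT₃_pos [NeZero H] (hH : Integrable (fun z : ℝ × ℝ ↦ z) H)
    (hY : ∀ c : ℝ, ¬ ∀ᵐ z ∂H, z.2 = c) : 0 < giniT₃ H := by
  rw [giniT₃_eq_kernelMean hH]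
  exact kernelMean_pos (f := Prod.snd) isPairKernel_giniKernel₃ hH giniKernel₃_nonneg
    (fun z w h ↦ (sub_eq_zero.1 (snd_eq_zero_of_giniKernel₃_eq_zero h)).symm) hY

end GiniMean

/-! ### Second moments of degenerate U-statistics -/

section UStatistic

variable {Ω α : Type*} [MeasurableSpace Ω] [MeasurableSpace α] {P : Measure Ω} {H : Measure α}

lemma integral_sq_sum_of_orthogonal {ι : Type*} (s : Finset ι) {f : ι → Ω → ℝ} {c : ℝ}
    (hf : ∀ i ∈ s, MemLp (f i) 2 P) (hc : ∀ i ∈ s, ∫ ω, f i ω ^ 2 ∂P = c)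
    (ho : ∀ i ∈ s, ∀ j ∈ s, i ≠ j → ∫ ω, f i ω * f j ω ∂P = 0) :
    ∫ ω, (∑ i ∈ s, f i ω) ^ 2 ∂P = s.card * c := by
  simp only [sq, Finset.sum_mul_sum]
  have hint : ∀ i ∈ s, ∀ j ∈ s, Integrable (fun ω ↦ f i ω * f j ω) P :=
    fun i hi j hj ↦ (hf i hi).integrable_mul (hf j hj)
  rw [integral_finsetSum _ fun i hi ↦ integrable_finsetSum _ (hint i hi), ← nsmul_eq_mul,
    ← Finset.sum_const]
  refine Finset.sum_congr rfl fun i hi ↦ ?_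
  rw [integral_finsetSum _ (hint i hi), Finset.sum_eq_single_of_mem i hi
    fun j hj hji ↦ ho i hi j hj hji.symm, ← hc i hi]
  simp only [sq]

lemma hasLaw_pair [IsProbabilityMeasure P] {Z : ℕ → Ω → α}
    (hlaw : ∀ i, HasLaw (Z i) H P) (hindep : iIndepFun Z P)
    {i j : ℕ} (hij : i ≠ j) :
    HasLaw (fun ω ↦ (Z i ω, Z j ω)) (H.prod H) P :=
  (hindep.indepFun hij).hasLaw_prod (hlaw i) (hlaw j)

variable [IsProbabilityMeasure P]

/-- Averaging out a variable that is independent of the others: if every section of `Φ` in its first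
argument has mean zero, then so does `Φ (A, W)`. -/
lemma integral_comp_prodMk_eq_zero [IsProbabilityMeasure H] {β : Type*} [MeasurableSpace β]
    {A : Ω → α} {W : Ω → β} {Φ : α × β → ℝ} (hA : HasLaw A H P)
    (hW : AEMeasurable W P) (hAW : IndepFun A W P) (hΦ : Measurable Φ)
    (hint : Integrable (fun ω ↦ Φ (A ω, W ω)) P)
    (h0 : ∀ w, ∫ a, Φ (a, w) ∂H = 0) : ∫ ω, Φ (A ω, W ω) ∂P = 0 := by
  have hW' : HasLaw W (P.map W) P := ⟨hW, rfl⟩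
  have : IsProbabilityMeasure (P.map W) := Measure.isProbabilityMeasure_map hW
  have hlaw : HasLaw (fun ω ↦ (A ω, W ω)) (H.prod (P.map W)) P := hAW.hasLaw_prod hA hW'
  have hint' : Integrable Φ (H.prod (P.map W)) := by
    rw [← hlaw.map_eq]
    exact (integrable_map_measure hΦ.aestronglyMeasurable hlaw.aemeasurable).2 hint
  have := hlaw.integral_comp hΦ.aestronglyMeasurable
  rw [Function.comp_def] at this
  rw [this, integral_prod_symm _ hint']
  simp [h0]

/-- A degenerate kernel of order two: symmetric, square integrable, and with both conditional means
equal to zero everywhere. -/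
structure IsDegenerateKernel (h : α × α → ℝ) (H : Measure α) : Prop where
  measurable : Measurable h
  memLp : MemLp h 2 (H.prod H)
  symm : ∀ x y, h (x, y) = h (y, x)
  integral_eq_zero : ∀ y, ∫ x, h (x, y) ∂H = 0

variable {Z : ℕ → Ω → α} {h : α × α → ℝ}

namespace IsDegenerateKernel

lemma memLp_pair (hh : IsDegenerateKernel h H) (hlaw : ∀ i, HasLaw (Z i) H P)
    (hindep : iIndepFun Z P) {i j : ℕ} (hij : i ≠ j) :
    MemLp (fun ω ↦ h (Z i ω, Z j ω)) 2 P := by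
  have hl := hasLaw_pair hlaw hindep hij
  have hm := hh.memLp
  rw [← hl.map_eq] at hm
  exact hm.comp_of_map hl.aemeasurable

lemma integral_sq_pair (hh : IsDegenerateKernel h H) (hlaw : ∀ i, HasLaw (Z i) H P)
    (hindep : iIndepFun Z P) {i j : ℕ} (hij : i ≠ j) :
    ∫ ω, h (Z i ω, Z j ω) ^ 2 ∂P = ∫ p, h p ^ 2 ∂(H.prod H) :=
  (hasLaw_pair hlaw hindep hij).integral_comp (f := fun p ↦ h p ^ 2)
    (hh.measurable.pow_const 2).aestronglyMeasurable

/-- Two values of a degenerate kernel are orthogonal as soon as one sample point occurs in only one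
of them. -/
lemma integral_mul_eq_zero [IsProbabilityMeasure H] (hh : IsDegenerateKernel h H)
    (hlaw : ∀ i, HasLaw (Z i) H P) (hindep : iIndepFun Z P) {a b c d : ℕ}
    (hab : a ≠ b) (hac : a ≠ c) (had : a ≠ d) (hcd : c ≠ d) :
    ∫ ω, h (Z a ω, Z b ω) * h (Z c ω, Z d ω) ∂P = 0 := by
  have hZ : ∀ i, AEMeasurable (Z i) P := fun i ↦ (hlaw i).aemeasurable
  have hind : IndepFun (Z a) (fun ω ↦ (Z b ω, Z c ω, Z d ω)) P := by
    have hdisj : Disjoint ({a} : Finset ℕ) {b, c, d} := by simp [hab, hac, had]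
    have hb : b ∈ ({b, c, d} : Finset ℕ) := by simp
    have hc : c ∈ ({b, c, d} : Finset ℕ) := by simp
    have hd : d ∈ ({b, c, d} : Finset ℕ) := by simp
    exact (hindep.indepFun_finset₀ {a} {b, c, d} hdisj hZ).comp
      (φ := fun u : ({a} : Finset ℕ) → α ↦ u ⟨a, Finset.mem_singleton_self a⟩)
      (ψ := fun v : ({b, c, d} : Finset ℕ) → α ↦ (v ⟨b, hb⟩, v ⟨c, hc⟩, v ⟨d, hd⟩))
      (by fun_prop) (by fun_prop)
  refine integral_comp_prodMk_eq_zero (Φ := fun p : α × α × α × α ↦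
    h (p.1, p.2.1) * h (p.2.2.1, p.2.2.2)) (hlaw a) (by fun_prop) hind ?_ ?_ fun w ↦ ?_
  · have := hh.measurable
    fun_prop
  · exact (hh.memLp_pair hlaw hindep hab).integrable_mul (hh.memLp_pair hlaw hindep hcd)
  · change ∫ x, h (x, w.1) * h (w.2.1, w.2.2) ∂H = 0
    rw [integral_mul_const, hh.integral_eq_zero, zero_mul]

/-- The U-statistic of a degenerate kernel is of order `n` in `L²`: its terms are pairwise
orthogonal, and there are at most `n²` of them. -/
lemma integral_sq_sum_le [IsProbabilityMeasure H] (hh : IsDegenerateKernel h H)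
    (hlaw : ∀ i, HasLaw (Z i) H P) (hindep : iIndepFun Z P) (n : ℕ) :
    ∫ ω, (∑ j ∈ Finset.range n, ∑ i ∈ Finset.range j, h (Z i ω, Z j ω)) ^ 2 ∂P ≤
      (n : ℝ) ^ 2 * ∫ p, h p ^ 2 ∂(H.prod H) := by
  simp only [Finset.sum_sigma']
  rw [integral_sq_sum_of_orthogonal (f := fun (q : (_ : ℕ) × ℕ) ω ↦ h (Z q.2 ω, Z q.1 ω))
    (c := ∫ p, h p ^ 2 ∂(H.prod H))]
  · refine mul_le_mul_of_nonneg_right ?_ (integral_nonneg fun _ ↦ sq_nonneg _)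
    have : ((Finset.range n).sigma fun j ↦ Finset.range j).card ≤ n ^ 2 := by
      rw [Finset.card_sigma]
      refine (Finset.sum_le_card_nsmul _ _ n fun j hj ↦ ?_).trans (by simp [sq])
      simpa using (Finset.mem_range.1 hj).le
    exact_mod_cast this
  · rintro ⟨j, i⟩ hp
    simp only [Finset.mem_sigma, Finset.mem_range] at hp
    exact hh.memLp_pair hlaw hindep hp.2.ne
  · rintro ⟨j, i⟩ hp
    simp only [Finset.mem_sigma, Finset.mem_range] at hp
    exact hh.integral_sq_pair hlaw hindep hp.2.ne
  · rintro ⟨j, i⟩ hp ⟨l, m⟩ hq hne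
    simp only [Finset.mem_sigma, Finset.mem_range] at hp hq ⊢
    rcases lt_trichotomy j l with hjl | rfl | hjl
    · simp only [mul_comm (h (Z i _, Z j _)), hh.symm (Z m _)]
      exact hh.integral_mul_eq_zero hlaw hindep hq.2.ne' (hp.2.trans hjl).ne' hjl.ne' hp.2.ne
    · refine hh.integral_mul_eq_zero hlaw hindep hp.2.ne (fun him ↦ hne ?_) hp.2.ne hq.2.ne
      rw [him]
    · simp only [hh.symm (Z i _)]
      exact hh.integral_mul_eq_zero hlaw hindep hp.2.ne' (hq.2.trans hjl).ne' hjl.ne' hq.2.ne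

end IsDegenerateKernel

end UStatistic

/-! ### Boundedness in probability, the delta method, and passing to the mean -/

section BoundedInProbability

variable {Ω : Type*} [MeasurableSpace Ω] {P : Measure Ω}

/-- Boundedness in probability of a sequence of random vectors, uniformly over the whole sequence
and not only eventually. -/
def IsBoundedInProbability {E : Type*} [Norm E] (P : Measure Ω) (X : ℕ → Ω → E) : Prop :=
  ∀ ε : ℝ, 0 < ε → ∃ M : ℝ, ∀ n, P {ω | M < ‖X n ω‖} ≤ ENNReal.ofReal ε

lemma IsBoundedInProbability.prodMk {E F : Type*} [SeminormedAddCommGroup E]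
    [SeminormedAddCommGroup F] {X : ℕ → Ω → E} {Y : ℕ → Ω → F} (hX : IsBoundedInProbability P X)
    (hY : IsBoundedInProbability P Y) :
    IsBoundedInProbability P (fun n ω ↦ (X n ω, Y n ω)) := by
  intro ε hε
  obtain ⟨M, hM⟩ := hX (ε / 2) (half_pos hε)
  obtain ⟨N, hN⟩ := hY (ε / 2) (half_pos hε)
  refine ⟨max M N, fun n ↦ ?_⟩
  have hsub : {ω | max M N < ‖(X n ω, Y n ω)‖} ⊆ {ω | M < ‖X n ω‖} ∪ {ω | N < ‖Y n ω‖} := by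
    intro ω hω
    rw [Set.mem_ofPred_eq, Prod.norm_mk] at hω
    rcases lt_max_iff.1 hω with h | h
    · exact Or.inl ((le_max_left _ _).trans_lt h)
    · exact Or.inr ((le_max_right _ _).trans_lt h)
  calc P {ω | max M N < ‖(X n ω, Y n ω)‖} ≤ ENNReal.ofReal (ε / 2) + ENNReal.ofReal (ε / 2) :=
        (measure_mono hsub).trans ((measure_union_le _ _).trans (add_le_add (hM n) (hN n)))
    _ = ENNReal.ofReal ε := by
        rw [← ENNReal.ofReal_add (half_pos hε).le (half_pos hε).le, add_halves]

/-- A sequence that converges in distribution is bounded in probability, because a convergent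
sequence of laws together with its limit is compact, hence tight. -/
lemma isBoundedInProbability_of_tendstoInDistribution [IsProbabilityMeasure P] {Ω' : Type*}
    [MeasurableSpace Ω'] {Q : Measure Ω'} [IsProbabilityMeasure Q] {X : ℕ → Ω → ℝ} {Y : Ω' → ℝ}
    (h : TendstoInDistribution X atTop Y (fun _ ↦ P) Q) : IsBoundedInProbability P X := by
  intro ε hε
  have hc := h.tendsto.isCompact_insert_range
  have ht := isTightMeasureSet_of_isCompact_closure (by rwa [hc.isClosed.closure_eq])
  obtain ⟨K, hK, hKle⟩ := isTightMeasureSet_iff_exists_isCompact_measure_compl_le.1 ht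
    (ENNReal.ofReal ε) (ENNReal.ofReal_pos.2 hε)
  obtain ⟨M, hM⟩ := hK.isBounded.subset_closedBall (0 : ℝ)
  refine ⟨M, fun n ↦ ?_⟩
  have hn := hKle (P.map (X n)) ⟨_, Set.mem_insert_of_mem _ ⟨n, rfl⟩, rfl⟩
  refine le_trans ?_ hn
  rw [Measure.map_apply_of_aemeasurable (h.forall_aemeasurable n) hK.measurableSet.compl]
  refine measure_mono fun ω hω hω' ↦ ?_
  have := hM hω'
  rw [mem_closedBall_zero_iff] at this
  exact this.not_gt hω

/-- The remainder in the delta method: a first order expansion at `θ` holds up to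
`o_P(n ^ (-1 / 2))` along a `√n`-consistent sequence. -/
lemma tendstoInMeasure_delta_remainder [IsProbabilityMeasure P] {E : Type*} [NormedAddCommGroup E]
    [NormedSpace ℝ E] {f : E → ℝ} {f' : E →L[ℝ] ℝ} {θ : E} (hf : HasFDerivAt f f' θ)
    {V : ℕ → Ω → E} (hV : IsBoundedInProbability P (fun n ω ↦ Real.sqrt n • (V n ω - θ))) :
    TendstoInMeasure P
      (fun (n : ℕ) ω ↦ Real.sqrt n * (f (V n ω) - f θ - f' (V n ω - θ))) atTop 0 := by
  rw [tendstoInMeasure_iff_measureReal_norm]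
  intro ε hε
  rw [Metric.tendsto_atTop']
  intro κ hκ
  obtain ⟨M, hM⟩ := hV (κ / 2) (half_pos hκ)
  have hM' : 0 < max M 1 := zero_lt_one.trans_le (le_max_right _ _)
  have hη : 0 < ε / (2 * max M 1) := by positivity
  obtain ⟨δ, hδ, hball⟩ := Metric.eventually_nhds_iff.1 (hf.isLittleO.def hη)
  obtain ⟨N, hN⟩ := ((Real.tendsto_sqrt_atTop.comp tendsto_natCast_atTop_atTop).eventually_gt_atTop
    (max M 1 / δ)).exists_forall_of_atTop
  refine ⟨N, fun n hn ↦ ?_⟩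
  have hsqrt : max M 1 / δ < Real.sqrt n := hN n hn.le
  have hpos : 0 < Real.sqrt n := (div_pos hM' hδ).trans hsqrt
  have hsub : {ω | ε ≤ ‖Real.sqrt n * (f (V n ω) - f θ - f' (V n ω - θ)) - (0 : Ω → ℝ) ω‖} ⊆
      {ω | M < ‖Real.sqrt n • (V n ω - θ)‖} := by
    intro ω hω
    by_contra hlt
    simp only [Set.mem_ofPred_eq, not_lt, norm_smul, Real.norm_eq_abs, abs_of_pos hpos] at hlt
    have hle : Real.sqrt n * ‖V n ω - θ‖ ≤ max M 1 := hlt.trans (le_max_left _ _)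
    have hdist : dist (V n ω) θ < δ := by
      rw [dist_eq_norm]
      rw [div_lt_iff₀ hδ] at hsqrt
      exact lt_of_mul_lt_mul_left (hle.trans_lt hsqrt) hpos.le
    have hr := hball hdist
    simp only [Set.mem_ofPred_eq, Pi.zero_apply, sub_zero, norm_mul] at hω
    rw [Real.norm_eq_abs (Real.sqrt n), abs_of_pos hpos] at hω
    have : Real.sqrt n * ‖f (V n ω) - f θ - f' (V n ω - θ)‖ ≤ ε / 2 :=
      calc Real.sqrt n * ‖f (V n ω) - f θ - f' (V n ω - θ)‖
          ≤ Real.sqrt n * (ε / (2 * max M 1) * ‖V n ω - θ‖) :=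
            mul_le_mul_of_nonneg_left hr hpos.le
        _ = ε / (2 * max M 1) * (Real.sqrt n * ‖V n ω - θ‖) := by ring
        _ ≤ ε / (2 * max M 1) * max M 1 := mul_le_mul_of_nonneg_left hle hη.le
        _ = ε / 2 := by field_simp
    linarith
  have hle : P.real {ω | ε ≤ ‖Real.sqrt n * (f (V n ω) - f θ - f' (V n ω - θ)) -
      (0 : Ω → ℝ) ω‖} ≤ κ / 2 :=
    ENNReal.toReal_le_of_le_ofReal (half_pos hκ).le ((measure_mono hsub).trans (hM n))
  rw [Real.dist_eq, sub_zero, abs_of_nonneg measureReal_nonneg]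
  linarith

lemma tendstoInMeasure_of_isBoundedInProbability_sqrt_mul [IsProbabilityMeasure P]
    {X : ℕ → Ω → ℝ} {c : ℝ}
    (h : IsBoundedInProbability P (fun n ω ↦ Real.sqrt n * (X n ω - c))) :
    TendstoInMeasure P X atTop (fun _ ↦ c) := by
  rw [tendstoInMeasure_iff_measureReal_norm]
  intro ε hε
  rw [Metric.tendsto_atTop']
  intro κ hκ
  obtain ⟨M, hM⟩ := h (κ / 2) (half_pos hκ)
  obtain ⟨N, hN⟩ := ((Real.tendsto_sqrt_atTop.comp tendsto_natCast_atTop_atTop).eventually_gt_atTop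
    (M / ε)).exists_forall_of_atTop
  refine ⟨N, fun n hn ↦ ?_⟩
  have hsqrt : M / ε < Real.sqrt n := hN n hn.le
  have hsub : {ω | ε ≤ ‖X n ω - c‖} ⊆ {ω | M < ‖Real.sqrt n * (X n ω - c)‖} := by
    intro ω hω
    rw [Set.mem_ofPred_eq, norm_mul, Real.norm_eq_abs (Real.sqrt n), abs_of_nonneg (by positivity)]
    rw [div_lt_iff₀ hε] at hsqrt
    exact hsqrt.trans_le (mul_le_mul_of_nonneg_left hω (Real.sqrt_nonneg _))
  have hle : P.real {ω | ε ≤ ‖X n ω - c‖} ≤ κ / 2 :=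
    ENNReal.toReal_le_of_le_ofReal (half_pos hκ).le ((measure_mono hsub).trans (hM n))
  rw [Real.dist_eq, sub_zero, abs_of_nonneg measureReal_nonneg]
  linarith

/-- Bounded convergence for convergence in probability. -/
lemma tendsto_integral_of_tendstoInMeasure_of_bounded [IsProbabilityMeasure P] {X : ℕ → Ω → ℝ}
    {Y : Ω → ℝ} {C : ℝ} (hX : ∀ n, AEStronglyMeasurable (X n) P) (hC : ∀ n ω, |X n ω| ≤ C)
    (h : TendstoInMeasure P X atTop Y) :
    Tendsto (fun n ↦ ∫ ω, X n ω ∂P) atTop (𝓝 (∫ ω, Y ω ∂P)) := by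
  refine tendsto_of_subseq_tendsto fun ns hns ↦ ?_
  obtain ⟨ms, -, hms⟩ := (h.comp hns).exists_seq_tendsto_ae
  exact ⟨ms, tendsto_integral_of_dominated_convergence (fun _ ↦ C) (fun n ↦ hX _)
    (integrable_const C) (fun n ↦ ae_of_all _ fun ω ↦ hC _ ω) hms⟩

/-- Chebyshev: second moments tending to zero force convergence to zero in probability. -/
lemma tendstoInMeasure_zero_of_integral_sq_le [IsFiniteMeasure P] {X : ℕ → Ω → ℝ} {b : ℕ → ℝ}
    (hX : ∀ n, MemLp (X n) 2 P) (hb : ∀ᶠ n in atTop, ∫ ω, X n ω ^ 2 ∂P ≤ b n)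
    (hb0 : Tendsto b atTop (𝓝 0)) : TendstoInMeasure P X atTop 0 := by
  rw [tendstoInMeasure_iff_measureReal_norm]
  intro ε hε
  have hlim : Tendsto (fun n ↦ b n / ε ^ 2) atTop (𝓝 0) := by simpa using hb0.div_const (ε ^ 2)
  refine tendsto_of_tendsto_of_tendsto_of_le_of_le' tendsto_const_nhds hlim
    (Eventually.of_forall fun n ↦ measureReal_nonneg) (hb.mono fun n hn ↦ ?_)
  rw [le_div_iff₀ (by positivity), mul_comm]
  refine le_trans ?_ ((mul_meas_ge_le_integral_of_nonneg (ae_of_all _ fun ω ↦ sq_nonneg (X n ω))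
    (hX n).integrable_sq (ε ^ 2)).trans hn)
  refine mul_le_mul_of_nonneg_left (measureReal_mono fun ω hω ↦ ?_) (by positivity)
  simp only [Set.mem_ofPred_eq, Pi.zero_apply, sub_zero, Real.norm_eq_abs] at hω ⊢
  rw [← sq_abs (X n ω)]
  exact pow_le_pow_left₀ hε.le hω 2

end BoundedInProbability

/-! ### The derivative of the correlation in terms of the three covariances -/

/-- The correlation `u₂ / (√u₁ √u₃)` as a function of `(u₁, u₂, u₃)`. -/
noncomputable def corrOfCov (u : ℝ × ℝ × ℝ) : ℝ := u.2.1 / (Real.sqrt u.1 * Real.sqrt u.2.2)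

/-- The differential of `corrOfCov` at a point with positive first and third coordinate. -/
noncomputable def corrDeriv (t : ℝ × ℝ × ℝ) : ℝ × ℝ × ℝ →L[ℝ] ℝ :=
  (-(corrOfCov t / (2 * t.1))) • ContinuousLinearMap.fst ℝ ℝ (ℝ × ℝ) +
    (1 / (Real.sqrt t.1 * Real.sqrt t.2.2)) •
      (ContinuousLinearMap.fst ℝ ℝ ℝ).comp (ContinuousLinearMap.snd ℝ ℝ (ℝ × ℝ)) +
    (-(corrOfCov t / (2 * t.2.2))) •
      (ContinuousLinearMap.snd ℝ ℝ ℝ).comp (ContinuousLinearMap.snd ℝ ℝ (ℝ × ℝ))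

lemma corrDeriv_apply (t v : ℝ × ℝ × ℝ) :
    corrDeriv t v = -(corrOfCov t / (2 * t.1)) * v.1 +
      1 / (Real.sqrt t.1 * Real.sqrt t.2.2) * v.2.1 +
      -(corrOfCov t / (2 * t.2.2)) * v.2.2 := rfl

lemma hasFDerivAt_corrOfCov {t : ℝ × ℝ × ℝ} (h1 : 0 < t.1) (h3 : 0 < t.2.2) :
    HasFDerivAt corrOfCov (corrDeriv t) t := by
  have d1 : HasFDerivAt (fun u : ℝ × ℝ × ℝ ↦ u.1) (ContinuousLinearMap.fst ℝ ℝ (ℝ × ℝ)) t :=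
    hasFDerivAt_fst
  have d2 : HasFDerivAt (fun u : ℝ × ℝ × ℝ ↦ u.2.1)
      ((ContinuousLinearMap.fst ℝ ℝ ℝ).comp (ContinuousLinearMap.snd ℝ ℝ (ℝ × ℝ))) t :=
    hasFDerivAt_fst.comp t hasFDerivAt_snd
  have d3 : HasFDerivAt (fun u : ℝ × ℝ × ℝ ↦ u.2.2)
      ((ContinuousLinearMap.snd ℝ ℝ ℝ).comp (ContinuousLinearMap.snd ℝ ℝ (ℝ × ℝ))) t :=
    hasFDerivAt_snd.comp t hasFDerivAt_snd
  have s1 : Real.sqrt t.1 ≠ 0 := (Real.sqrt_pos.2 h1).ne'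
  have s3 : Real.sqrt t.2.2 ≠ 0 := (Real.sqrt_pos.2 h3).ne'
  refine (d2.fun_mul ((hasFDerivAt_inv (mul_ne_zero s1 s3)).comp t
    ((d1.sqrt h1.ne').mul (d3.sqrt h3.ne')))).congr_fderiv ?_
  refine ContinuousLinearMap.ext fun v ↦ ?_
  have q1 : Real.sqrt t.1 ^ 2 = t.1 := Real.sq_sqrt h1.le
  have q3 : Real.sqrt t.2.2 ^ 2 = t.2.2 := Real.sq_sqrt h3.le
  rw [corrDeriv_apply, corrOfCov]
  simp
  generalize Real.sqrt t.1 = a at *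
  generalize Real.sqrt t.2.2 = b at *
  rw [← q1, ← q3]
  field_simp
  ring

/-! ### Hájek projection and asymptotic normality of pair averages -/

/-- A sequence that is asymptotic to the normalized sum of a centred square integrable function of
the sample is asymptotically normal. -/
lemma tendstoInDistribution_of_asymptotically_linear {Ω α : Type*} [MeasurableSpace Ω]
    [MeasurableSpace α] {P : Measure Ω} [IsProbabilityMeasure P] {H : Measure α} {Z : ℕ → Ω → α}
    {ψ : α → ℝ} (hψ : Measurable ψ)
    (hψ2 : MemLp ψ 2 H) (hψ0 : ∫ z, ψ z ∂H = 0) (hlaw : ∀ i, HasLaw (Z i) H P)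
    (hindep : iIndepFun Z P) {Y : ℕ → Ω → ℝ} (hY : ∀ n, AEMeasurable (Y n) P)
    (h : TendstoInMeasure P (fun (n : ℕ) ω ↦
      Y n ω - (Real.sqrt n)⁻¹ * ∑ i ∈ Finset.range n, ψ (Z i ω)) atTop 0) :
    TendstoInDistribution Y atTop (id : ℝ → ℝ) (fun _ ↦ P)
      (gaussianReal 0 (∫ z, ψ z ^ 2 ∂H).toNNReal) := by
  have hlaw' : ∀ i, HasLaw (fun ω ↦ ψ (Z i ω)) (H.map ψ) P := fun i ↦
    HasLaw.fun_comp ⟨hψ.aemeasurable, rfl⟩ (hlaw i)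
  have hmean : ∫ ω, ψ (Z 0 ω) ∂P = 0 := by
    rw [← hψ0]
    exact (hlaw 0).integral_comp hψ.aestronglyMeasurable
  have hvar : Var[fun ω ↦ ψ (Z 0 ω); P] = ∫ z, ψ z ^ 2 ∂H := by
    rw [variance_of_integral_eq_zero (hlaw' 0).aemeasurable hmean]
    exact (hlaw 0).integral_comp (f := fun z ↦ ψ z ^ 2) (hψ.pow_const 2).aestronglyMeasurable
  have hL : MemLp (fun ω ↦ ψ (Z 0 ω)) 2 P := by
    rw [← (hlaw 0).map_eq] at hψ2
    exact hψ2.comp_of_map (hlaw 0).aemeasurable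
  have hclt := tendstoInDistribution_inv_sqrt_mul_sum_sub (X := fun i ω ↦ ψ (Z i ω)) (P := P)
    (P' := gaussianReal 0 (∫ z, ψ z ^ 2 ∂H).toNNReal) (Y := id) (by rw [hvar]; exact HasLaw.id) hL
    (hindep.comp (fun _ ↦ ψ) fun _ ↦ hψ)
    fun i ↦ ⟨(hlaw' i).aemeasurable, (hlaw' 0).aemeasurable,
      (hlaw' i).map_eq.trans (hlaw' 0).map_eq.symm⟩
  simp only [hmean, mul_zero, sub_zero] at hclt
  exact tendstoInDistribution_of_tendstoInMeasure_sub Y id hclt h hY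

section PairMean

/-- The average of `k (z i - z j)` over the pairs `i < j < n`. -/
noncomputable def pairMean (k : ℝ × ℝ → ℝ) (n : ℕ) (z : ℕ → ℝ × ℝ) : ℝ :=
  pairSum k n z / (n * (n - 1) / 2)

lemma pairMean_add (k l : ℝ × ℝ → ℝ) (n : ℕ) (z : ℕ → ℝ × ℝ) :
    pairMean (fun d ↦ k d + l d) n z = pairMean k n z + pairMean l n z := by
  simp only [pairMean, pairSum, Finset.sum_add_distrib, add_div]

lemma pairMean_const_mul (k : ℝ × ℝ → ℝ) (a : ℝ) (n : ℕ) (z : ℕ → ℝ × ℝ) :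
    pairMean (fun d ↦ a * k d) n z = a * pairMean k n z := by
  simp only [pairMean, pairSum, ← Finset.mul_sum, mul_div_assoc]

/-- The part of a kernel that is left after both conditional means have been removed. -/
noncomputable def degeneratePart (k : ℝ × ℝ → ℝ) (H : Measure (ℝ × ℝ))
    (p : (ℝ × ℝ) × (ℝ × ℝ)) : ℝ :=
  k (p.1 - p.2) - kernelProj k H p.1 - kernelProj k H p.2 + kernelMean k H

/-- The Hoeffding decomposition of a sum over pairs. -/
lemma pairSum_eq_hoeffding (k : ℝ × ℝ → ℝ) (H : Measure (ℝ × ℝ)) (n : ℕ) (z : ℕ → ℝ × ℝ) :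
    pairSum k n z =
      ∑ j ∈ Finset.range n, ∑ i ∈ Finset.range j, degeneratePart k H (z i, z j) +
        (n - 1) * ∑ i ∈ Finset.range n, kernelProj k H (z i) -
        n * (n - 1) / 2 * kernelMean k H := by
  induction n with
  | zero => simp [pairSum]
  | succ n ih =>
    rw [pairSum] at ih ⊢
    rw [Finset.sum_range_succ, ih, Finset.sum_range_succ _ n, Finset.sum_range_succ _ n]
    simp only [degeneratePart, Finset.sum_add_distrib, Finset.sum_sub_distrib, Finset.sum_const,
      Finset.card_range, nsmul_eq_mul]
    push_cast
    ring

lemma IsPairKernel.isDegenerateKernel_degeneratePart {k : ℝ × ℝ → ℝ} (hk : IsPairKernel k)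
    {H : Measure (ℝ × ℝ)} [IsProbabilityMeasure H] (hH : MemLp (fun z : ℝ × ℝ ↦ z) 2 H) :
    IsDegenerateKernel (degeneratePart k H) H := by
  have hH1 : Integrable (fun z : ℝ × ℝ ↦ z) H := hH.integrable one_le_two
  have hg := hk.memLp_proj hH hH1
  refine ⟨?_, ?_, fun x y ↦ ?_, fun y ↦ ?_⟩
  · exact ((hk.measurable_sub.sub (hk.measurable_proj.comp measurable_fst)).sub
      (hk.measurable_proj.comp measurable_snd)).add_const _
  · exact (((hk.memLp_sub hH).sub (hg.comp_fst H)).sub (hg.comp_snd H)).add (memLp_const _)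
  · simp only [degeneratePart]
    rw [hk.sub_comm x y]
    ring
  · have h1 : Integrable (fun x ↦ k (x - y)) H :=
      (hk.integrable_sub_left hH1 y).congr (ae_of_all _ fun x ↦ hk.sub_comm y x)
    have h2 := hk.integrable_proj hH1
    have e1 : ∫ x, k (x - y) ∂H = kernelProj k H y :=
      integral_congr_ae (ae_of_all _ fun x ↦ hk.sub_comm x y)
    have e2 : ∫ x, kernelProj k H x ∂H = kernelMean k H := rfl
    simp only [degeneratePart]
    rw [integral_add (f := fun x ↦ k (x - y) - kernelProj k H x - kernelProj k H y)
        ((h1.sub h2).sub (integrable_const _)) (integrable_const _),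
      integral_sub (f := fun x ↦ k (x - y) - kernelProj k H x) (h1.sub h2) (integrable_const _),
      integral_sub h1 h2, e1, e2]
    simp

/-- Twice the centred projection of a kernel: the influence function of its mean. -/
noncomputable def kernelInfluence (k : ℝ × ℝ → ℝ) (H : Measure (ℝ × ℝ)) (z : ℝ × ℝ) : ℝ :=
  2 * (kernelProj k H z - kernelMean k H)

variable {k : ℝ × ℝ → ℝ} {H : Measure (ℝ × ℝ)} [IsProbabilityMeasure H]

lemma IsPairKernel.measurable_influence (hk : IsPairKernel k) :
    Measurable (kernelInfluence k H) :=
  (hk.measurable_proj.sub_const _).const_mul 2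

lemma IsPairKernel.memLp_influence (hk : IsPairKernel k) (hH : MemLp (fun z : ℝ × ℝ ↦ z) 2 H) :
    MemLp (kernelInfluence k H) 2 H :=
  ((hk.memLp_proj hH (hH.integrable one_le_two)).sub (memLp_const _)).const_mul 2

lemma IsPairKernel.integral_influence (hk : IsPairKernel k)
    (hH : Integrable (fun z : ℝ × ℝ ↦ z) H) : ∫ z, kernelInfluence k H z ∂H = 0 := by
  have h : ∫ x, kernelProj k H x ∂H = kernelMean k H := rfl
  simp only [kernelInfluence]
  rw [integral_const_mul, integral_sub (hk.integrable_proj hH) (integrable_const _), h]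
  simp

variable {Ω : Type*} [MeasurableSpace Ω] {P : Measure Ω} {Z : ℕ → Ω → ℝ × ℝ}

lemma IsPairKernel.aemeasurable_pairSum (hk : IsPairKernel k)
    (hZ : ∀ i, AEMeasurable (Z i) P) (n : ℕ) :
    AEMeasurable (fun ω ↦ pairSum k n (fun i ↦ Z i ω)) P :=
  Finset.aemeasurable_fun_sum _ fun j _ ↦ Finset.aemeasurable_fun_sum _ fun i _ ↦
    hk.measurable.comp_aemeasurable ((hZ i).sub (hZ j))

variable [IsProbabilityMeasure P]

/-- Hájek projection: the scaled error of a pair average is, up to `o_P(1)`, the normalized sum of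
the influence function over the sample. The error of this approximation is the degenerate part,
which has second moment `O(1 / n)` after scaling. -/
lemma IsPairKernel.tendstoInMeasure_hajek (hk : IsPairKernel k)
    (hH : MemLp (fun z : ℝ × ℝ ↦ z) 2 H) (hlaw : ∀ i, HasLaw (Z i) H P)
    (hindep : iIndepFun Z P) :
    TendstoInMeasure P (fun (n : ℕ) ω ↦
      Real.sqrt n * (pairMean k n (fun i ↦ Z i ω) - kernelMean k H) -
        (Real.sqrt n)⁻¹ * ∑ i ∈ Finset.range n, kernelInfluence k H (Z i ω)) atTop 0 := by
  have hdeg := hk.isDegenerateKernel_degeneratePart hH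
  set R : ℕ → Ω → ℝ := fun n ω ↦
    ∑ j ∈ Finset.range n, ∑ i ∈ Finset.range j, degeneratePart k H (Z i ω, Z j ω)
  set c : ℝ := ∫ p, degeneratePart k H p ^ 2 ∂(H.prod H)
  have hc0 : 0 ≤ c := integral_nonneg fun _ ↦ sq_nonneg _
  have hRL (n : ℕ) : MemLp (R n) 2 P :=
    memLp_finsetSum _ fun j _ ↦ memLp_finsetSum _ fun i hi ↦
      hdeg.memLp_pair hlaw hindep (Finset.mem_range.1 hi).ne
  have hmain : TendstoInMeasure P (fun (n : ℕ) ω ↦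
      Real.sqrt n / (n * (n - 1) / 2) * R n ω) atTop 0 := by
    refine tendstoInMeasure_zero_of_integral_sq_le (b := fun n ↦ 16 * c / n)
      (fun n ↦ (hRL n).const_mul _) ?_ (tendsto_const_div_atTop_nhds_zero_nat _)
    filter_upwards [eventually_ge_atTop 2] with n hn
    have hn' : (2 : ℝ) ≤ n := by exact_mod_cast hn
    have hn1 : (0 : ℝ) < n - 1 := by linarith
    simp only [mul_pow, div_pow]
    rw [integral_const_mul, Real.sq_sqrt (by positivity)]
    calc (n : ℝ) / (n ^ 2 * (n - 1) ^ 2 / 2 ^ 2) * ∫ ω, R n ω ^ 2 ∂P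
        ≤ (n : ℝ) / (n ^ 2 * (n - 1) ^ 2 / 2 ^ 2) * (n ^ 2 * c) :=
          mul_le_mul_of_nonneg_left (hdeg.integral_sq_sum_le hlaw hindep n) (by positivity)
      _ = 4 * c * (n / (n - 1) ^ 2) := by field_simp; ring
      _ ≤ 4 * c * (4 / n) := by
          refine mul_le_mul_of_nonneg_left ?_ (by positivity)
          rw [div_le_div_iff₀ (by positivity) (by positivity)]
          nlinarith
      _ = 16 * c / n := by ring
  refine hmain.congr' ?_ (EventuallyEq.refl _ _)
  filter_upwards [eventually_ge_atTop 2] with n hn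
  refine ae_of_all _ fun ω ↦ ?_
  have hn' : (2 : ℝ) ≤ n := by exact_mod_cast hn
  have hn1 : (n : ℝ) - 1 ≠ 0 := by linarith
  have hn0 : (n : ℝ) ≠ 0 := by linarith
  have hs0 : Real.sqrt n ≠ 0 := (Real.sqrt_pos.2 (by linarith)).ne'
  have hs : Real.sqrt n ^ 2 = n := Real.sq_sqrt (by linarith)
  simp only [pairMean, kernelInfluence, pairSum_eq_hoeffding k H n, ← Finset.mul_sum,
    Finset.sum_sub_distrib, Finset.sum_const, Finset.card_range, nsmul_eq_mul]
  change Real.sqrt n / (n * (n - 1) / 2) * R n ω = Real.sqrt n * ((R n ω + _ - _) / _ - _) - _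
  generalize R n ω = r
  generalize ∑ i ∈ Finset.range n, kernelProj k H (Z i ω) = g
  generalize kernelMean k H = θ
  generalize Real.sqrt n = s at hs hs0 ⊢
  have hs1 : s ^ 2 - 1 ≠ 0 := by rwa [hs]
  rw [← hs]
  field_simp
  ring

/-- Asymptotic normality of pair averages. -/
lemma IsPairKernel.tendstoInDistribution_pairMean (hk : IsPairKernel k)
    (hH : MemLp (fun z : ℝ × ℝ ↦ z) 2 H) (hlaw : ∀ i, HasLaw (Z i) H P)
    (hindep : iIndepFun Z P) :
    TendstoInDistribution (fun (n : ℕ) ω ↦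
      Real.sqrt n * (pairMean k n (fun i ↦ Z i ω) - kernelMean k H)) atTop (id : ℝ → ℝ)
      (fun _ ↦ P) (gaussianReal 0 (∫ z, kernelInfluence k H z ^ 2 ∂H).toNNReal) :=
  tendstoInDistribution_of_asymptotically_linear hk.measurable_influence (hk.memLp_influence hH)
    (hk.integral_influence (hH.integrable one_le_two)) hlaw hindep
    (fun n ↦ (((hk.aemeasurable_pairSum (fun i ↦ (hlaw i).aemeasurable) n).div_const _).sub_const
      _).const_mul _) (hk.tendstoInMeasure_hajek hH hlaw hindep)

end PairMean

/-! ### Influence functions -/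

lemma tendsto_influenceQuotient_of_hasDerivAt {T : Measure (ℝ × ℝ) → ℝ} {H : Measure (ℝ × ℝ)}
    {z : ℝ × ℝ} {q : ℝ → ℝ} {d : ℝ} (hq : HasDerivAt q d 0) (h0 : T H = q 0)
    (h : ∀ ε, 0 < ε → ε < 1 → T (contaminate H z ε) = q ε) :
    Tendsto (influenceQuotient T H z) (𝓝[>] 0) (𝓝 d) := by
  refine hq.tendsto_slope_zero_right.congr' ?_
  filter_upwards [Ioo_mem_nhdsGT (zero_lt_one (α := ℝ))] with ε hε
  rw [influenceQuotient, h ε hε.1 hε.2, h0, zero_add, smul_eq_mul, div_eq_inv_mul]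

/-- The derivative along the contamination path of the mean of a kernel. -/
lemma hasDerivAt_contaminationPath (m p : ℝ) :
    HasDerivAt (fun ε : ℝ ↦ (1 - ε) ^ 2 * m + 2 * ε * (1 - ε) * p) (2 * (p - m)) 0 := by
  have h1 : HasDerivAt (fun ε : ℝ ↦ 1 - ε) (-1) 0 := by
    simpa using (hasDerivAt_id (0 : ℝ)).const_sub 1
  have h2 : HasDerivAt (fun ε : ℝ ↦ 2 * ε) 2 0 := by
    simpa using (hasDerivAt_id (0 : ℝ)).const_mul 2
  refine (((h1.fun_pow 2).mul_const m).fun_add ((h2.fun_mul h1).mul_const p)).congr_deriv ?_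
  norm_num
  ring

section Influence

variable {H : Measure (ℝ × ℝ)} [IsProbabilityMeasure H]

/-- A functional that is a kernel mean on laws with a first moment has the centred projection,
doubled, as its influence function. -/
lemma tendsto_influenceQuotient_of_eq_kernelMean {T : Measure (ℝ × ℝ) → ℝ} {k : ℝ × ℝ → ℝ}
    (hk : IsPairKernel k) (hH : Integrable (fun z : ℝ × ℝ ↦ z) H)
    (hT : ∀ (G : Measure (ℝ × ℝ)) [IsFiniteMeasure G], Integrable (fun z : ℝ × ℝ ↦ z) G →
      T G = kernelMean k G) (z : ℝ × ℝ) :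
    Tendsto (influenceQuotient T H z) (𝓝[>] 0) (𝓝 (kernelInfluence k H z)) := by
  refine tendsto_influenceQuotient_of_hasDerivAt
    (hasDerivAt_contaminationPath (kernelMean k H) (kernelProj k H z)) (by simp [hT H hH])
    fun ε h0 h1 ↦ ?_
  have := isFiniteMeasure_contaminate H z ε
  rw [hT _ (integrable_id_contaminate hH z ε), kernelMean_contaminate hk hH z h0.le h1.le]

lemma tendsto_influenceQuotient_giniT₁ (hH : Integrable (fun z : ℝ × ℝ ↦ z) H) (z : ℝ × ℝ) :
    Tendsto (influenceQuotient giniT₁ H z) (𝓝[>] 0) (𝓝 (kernelInfluence giniKernel₁ H z)) :=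
  tendsto_influenceQuotient_of_eq_kernelMean isPairKernel_giniKernel₁ hH
    (fun _ _ h ↦ giniT₁_eq_kernelMean h) z

lemma tendsto_influenceQuotient_giniT₂ (hH : Integrable (fun z : ℝ × ℝ ↦ z) H) (z : ℝ × ℝ) :
    Tendsto (influenceQuotient giniT₂ H z) (𝓝[>] 0) (𝓝 (kernelInfluence giniKernel₂ H z)) :=
  tendsto_influenceQuotient_of_eq_kernelMean isPairKernel_giniKernel₂ hH
    (fun _ _ h ↦ giniT₂_eq_kernelMean h) z

lemma tendsto_influenceQuotient_giniT₃ (hH : Integrable (fun z : ℝ × ℝ ↦ z) H) (z : ℝ × ℝ) :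
    Tendsto (influenceQuotient giniT₃ H z) (𝓝[>] 0) (𝓝 (kernelInfluence giniKernel₃ H z)) :=
  tendsto_influenceQuotient_of_eq_kernelMean isPairKernel_giniKernel₃ hH
    (fun _ _ h ↦ giniT₃_eq_kernelMean h) z

lemma giniL₁_eq (hH : Integrable (fun z : ℝ × ℝ ↦ z) H) :
    giniL₁ H = kernelInfluence giniKernel₁ H :=
  funext fun z ↦ (tendsto_influenceQuotient_giniT₁ hH z).limUnder_eq

lemma giniL₂_eq (hH : Integrable (fun z : ℝ × ℝ ↦ z) H) :
    giniL₂ H = kernelInfluence giniKernel₂ H :=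
  funext fun z ↦ (tendsto_influenceQuotient_giniT₂ hH z).limUnder_eq

lemma giniL₃_eq (hH : Integrable (fun z : ℝ × ℝ ↦ z) H) :
    giniL₃ H = kernelInfluence giniKernel₃ H :=
  funext fun z ↦ (tendsto_influenceQuotient_giniT₃ hH z).limUnder_eq

/-- The triple of Gini covariances `(T₁, T₂, T₃)`. -/
noncomputable def giniCov (H : Measure (ℝ × ℝ)) : ℝ × ℝ × ℝ := (giniT₁ H, giniT₂ H, giniT₃ H)

/-- Chain rule for influence functions: that of `ρ_g` is the differential of the correlation applied
to those of `T₁, T₂, T₃`. -/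
lemma tendsto_influenceQuotient_giniCorr (hH : Integrable (fun z : ℝ × ℝ ↦ z) H)
    (h1 : 0 < giniT₁ H) (h3 : 0 < giniT₃ H) (z : ℝ × ℝ) :
    Tendsto (influenceQuotient giniCorr H z) (𝓝[>] 0)
      (𝓝 (corrDeriv (giniCov H) (kernelInfluence giniKernel₁ H z, kernelInfluence giniKernel₂ H z,
        kernelInfluence giniKernel₃ H z))) := by
  have hp (k : ℝ × ℝ → ℝ) := hasDerivAt_contaminationPath (kernelMean k H) (kernelProj k H z)
  have hpath := (hp giniKernel₁).prodMk ((hp giniKernel₂).prodMk (hp giniKernel₃))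
  have hcov : giniCov H = ((1 - 0) ^ 2 * kernelMean giniKernel₁ H + 2 * 0 * (1 - 0) *
      kernelProj giniKernel₁ H z, (1 - 0) ^ 2 * kernelMean giniKernel₂ H + 2 * 0 * (1 - 0) *
      kernelProj giniKernel₂ H z, (1 - 0) ^ 2 * kernelMean giniKernel₃ H + 2 * 0 * (1 - 0) *
      kernelProj giniKernel₃ H z) := by
    simp [giniCov, giniT₁_eq_kernelMean hH, giniT₂_eq_kernelMean hH, giniT₃_eq_kernelMean hH]
  have hf : HasFDerivAt corrOfCov (corrDeriv (giniCov H)) (giniCov H) :=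
    hasFDerivAt_corrOfCov h1 h3
  refine tendsto_influenceQuotient_of_hasDerivAt
    (HasFDerivAt.comp_hasDerivAt_of_eq (0 : ℝ) hf hpath hcov) ?_ fun ε e0 e1 ↦ ?_
  · simp only [Function.comp_apply, ← hcov]
    rfl
  · have := isFiniteMeasure_contaminate H z ε
    have hi := integrable_id_contaminate hH z ε
    simp only [Function.comp_apply,
      ← kernelMean_contaminate isPairKernel_giniKernel₁ hH z e0.le e1.le,
      ← kernelMean_contaminate isPairKernel_giniKernel₂ hH z e0.le e1.le,
      ← kernelMean_contaminate isPairKernel_giniKernel₃ hH z e0.le e1.le,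
      ← giniT₁_eq_kernelMean hi, ← giniT₂_eq_kernelMean hi, ← giniT₃_eq_kernelMean hi]
    rfl

/-! ### The linearized kernel of the Gini correlation -/

/-- The linear combination of the three Gini kernels with the partial derivatives of the correlation
at `(T₁, T₂, T₃)` as coefficients. -/
noncomputable def corrKernel (H : Measure (ℝ × ℝ)) (d : ℝ × ℝ) : ℝ :=
  -(giniCorr H / (2 * giniT₁ H)) * giniKernel₁ d +
    1 / (Real.sqrt (giniT₁ H) * Real.sqrt (giniT₃ H)) * giniKernel₂ d +
    -(giniCorr H / (2 * giniT₃ H)) * giniKernel₃ d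

lemma isPairKernel_corrKernel (H : Measure (ℝ × ℝ)) : IsPairKernel (corrKernel H) :=
  ((isPairKernel_giniKernel₁.const_mul _).add (isPairKernel_giniKernel₂.const_mul _)).add
    (isPairKernel_giniKernel₃.const_mul _)

lemma kernelProj_corrKernel (hH : Integrable (fun z : ℝ × ℝ ↦ z) H) (z : ℝ × ℝ) :
    kernelProj (corrKernel H) H z = corrDeriv (giniCov H)
      (kernelProj giniKernel₁ H z, kernelProj giniKernel₂ H z, kernelProj giniKernel₃ H z) := by
  have h1 := isPairKernel_giniKernel₁.const_mul (-(giniCorr H / (2 * giniT₁ H)))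
  have h2 := isPairKernel_giniKernel₂.const_mul
    (1 / (Real.sqrt (giniT₁ H) * Real.sqrt (giniT₃ H)))
  have h3 := isPairKernel_giniKernel₃.const_mul (-(giniCorr H / (2 * giniT₃ H)))
  refine ((h1.add h2).kernelProj_add h3 hH z).trans ?_
  rw [h1.kernelProj_add h2 hH, kernelProj_const_mul, kernelProj_const_mul, kernelProj_const_mul]
  rfl

lemma kernelMean_corrKernel (hH : Integrable (fun z : ℝ × ℝ ↦ z) H) :
    kernelMean (corrKernel H) H = corrDeriv (giniCov H) (giniCov H) := by
  have h1 := isPairKernel_giniKernel₁.const_mul (-(giniCorr H / (2 * giniT₁ H)))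
  have h2 := isPairKernel_giniKernel₂.const_mul
    (1 / (Real.sqrt (giniT₁ H) * Real.sqrt (giniT₃ H)))
  have h3 := isPairKernel_giniKernel₃.const_mul (-(giniCorr H / (2 * giniT₃ H)))
  refine ((h1.add h2).kernelMean_add h3 hH).trans ?_
  rw [h1.kernelMean_add h2 hH, kernelMean_const_mul, kernelMean_const_mul, kernelMean_const_mul,
    ← giniT₁_eq_kernelMean hH, ← giniT₂_eq_kernelMean hH, ← giniT₃_eq_kernelMean hH]
  rfl

lemma kernelInfluence_corrKernel (hH : Integrable (fun z : ℝ × ℝ ↦ z) H) (z : ℝ × ℝ) :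
    kernelInfluence (corrKernel H) H z = corrDeriv (giniCov H)
      (kernelInfluence giniKernel₁ H z, kernelInfluence giniKernel₂ H z,
        kernelInfluence giniKernel₃ H z) := by
  rw [kernelInfluence, kernelProj_corrKernel hH, kernelMean_corrKernel hH]
  simp only [kernelInfluence, giniCov, corrDeriv_apply, giniT₁_eq_kernelMean hH,
    giniT₂_eq_kernelMean hH, giniT₃_eq_kernelMean hH]
  ring

lemma influenceFunction_giniCorr (hH : Integrable (fun z : ℝ × ℝ ↦ z) H)
    (h1 : 0 < giniT₁ H) (h3 : 0 < giniT₃ H) :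
    influenceFunction giniCorr H = kernelInfluence (corrKernel H) H := by
  funext z
  rw [kernelInfluence_corrKernel hH]
  exact (tendsto_influenceQuotient_giniCorr hH h1 h3 z).limUnder_eq

end Influence

lemma integral_sq_linear_combination {α : Type*} [MeasurableSpace α] {μ : Measure α}
    {f g h : α → ℝ} (hf : MemLp f 2 μ) (hg : MemLp g 2 μ) (hh : MemLp h 2 μ) (a b c : ℝ) :
    ∫ x, (a * f x + b * g x + c * h x) ^ 2 ∂μ =
      a ^ 2 * ∫ x, f x ^ 2 ∂μ + b ^ 2 * ∫ x, g x ^ 2 ∂μ + c ^ 2 * ∫ x, h x ^ 2 ∂μ +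
        2 * a * b * ∫ x, f x * g x ∂μ + 2 * a * c * ∫ x, f x * h x ∂μ +
        2 * b * c * ∫ x, g x * h x ∂μ := by
  have e : ∀ x, (a * f x + b * g x + c * h x) ^ 2 =
      a ^ 2 * f x ^ 2 + b ^ 2 * g x ^ 2 + c ^ 2 * h x ^ 2 + 2 * a * b * (f x * g x) +
        2 * a * c * (f x * h x) + 2 * b * c * (g x * h x) := fun x ↦ by ring
  have i1 := hf.integrable_sq.const_mul (a ^ 2)
  have i2 := hg.integrable_sq.const_mul (b ^ 2)
  have i3 := hh.integrable_sq.const_mul (c ^ 2)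
  have i4 : Integrable (fun x ↦ 2 * a * b * (f x * g x)) μ := (hf.integrable_mul hg).const_mul _
  have i5 : Integrable (fun x ↦ 2 * a * c * (f x * h x)) μ := (hf.integrable_mul hh).const_mul _
  have i6 : Integrable (fun x ↦ 2 * b * c * (g x * h x)) μ := (hg.integrable_mul hh).const_mul _
  simp only [e]
  rw [integral_add ((((i1.fun_add i2).fun_add i3).fun_add i4).fun_add i5) i6,
    integral_add (((i1.fun_add i2).fun_add i3).fun_add i4) i5,
    integral_add ((i1.fun_add i2).fun_add i3) i4, integral_add (i1.fun_add i2) i3,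
    integral_add i1 i2]
  simp only [integral_const_mul]

/-! ### The sample Gini correlation -/

/-- The triple of sample Gini covariances. -/
noncomputable def sampleGiniCov (n : ℕ) (z : ℕ → ℝ × ℝ) : ℝ × ℝ × ℝ :=
  (pairMean giniKernel₁ n z, pairMean giniKernel₂ n z, pairMean giniKernel₃ n z)

/-- The normalization of the pair sums cancels in the correlation. For `n < 2` all the sums are
empty and both sides are zero. -/
lemma sampleGiniCorr_eq (n : ℕ) (z : ℕ → ℝ × ℝ) :
    sampleGiniCorr n z = corrOfCov (sampleGiniCov n z) := by
  rcases lt_or_ge n 2 with hn | hn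
  · interval_cases n <;> simp [sampleGiniCorr, corrOfCov, sampleGiniCov, pairMean, pairSum]
  · have hn' : (2 : ℝ) ≤ n := by exact_mod_cast hn
    have hn1 : (0 : ℝ) < n - 1 := by linarith
    have hc : (0 : ℝ) < n * (n - 1) / 2 := by positivity
    simp only [corrOfCov, sampleGiniCov, pairMean]
    rw [Real.sqrt_div' _ hc.le, Real.sqrt_div' _ hc.le, div_mul_div_comm,
      Real.mul_self_sqrt hc.le, div_div_div_cancel_right₀ hc.ne']
    rfl

/-- Cauchy–Schwarz over the pairs. -/
lemma abs_sampleGiniCorr_le_one (n : ℕ) (z : ℕ → ℝ × ℝ) : |sampleGiniCorr n z| ≤ 1 := by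
  have h13 : ∀ d, giniKernel₂ d ^ 2 = giniKernel₁ d * giniKernel₃ d := fun d ↦ by
    simp only [giniKernel₁, giniKernel₂, giniKernel₃]
    ring
  have hcs : pairSum giniKernel₂ n z ^ 2 ≤ pairSum giniKernel₁ n z * pairSum giniKernel₃ n z := by
    simp only [pairSum, Finset.sum_sigma']
    exact Finset.sum_sq_le_sum_mul_sum_of_sq_le_mul _ (fun _ _ ↦ giniKernel₁_nonneg _)
      (fun _ _ ↦ giniKernel₃_nonneg _) fun _ _ ↦ (h13 _).le
  have h0 : 0 ≤ pairSum giniKernel₁ n z :=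
    Finset.sum_nonneg fun _ _ ↦ Finset.sum_nonneg fun _ _ ↦ giniKernel₁_nonneg _
  change |pairSum giniKernel₂ n z / (Real.sqrt (pairSum giniKernel₁ n z) *
    Real.sqrt (pairSum giniKernel₃ n z))| ≤ 1
  rw [← Real.sqrt_mul h0, abs_div, abs_of_nonneg (Real.sqrt_nonneg _)]
  exact div_le_one_of_le₀ (Real.abs_le_sqrt hcs) (Real.sqrt_nonneg _)

section Sample

variable {Ω : Type*} [MeasurableSpace Ω] {P : Measure Ω} {H : Measure (ℝ × ℝ)}
  {Z : ℕ → Ω → ℝ × ℝ}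

lemma aemeasurable_sampleGiniCorr (hZ : ∀ i, AEMeasurable (Z i) P) (n : ℕ) :
    AEMeasurable (fun ω ↦ sampleGiniCorr n (fun i ↦ Z i ω)) P :=
  (isPairKernel_giniKernel₂.aemeasurable_pairSum hZ n).div
    ((isPairKernel_giniKernel₁.aemeasurable_pairSum hZ n).sqrt.mul
      (isPairKernel_giniKernel₃.aemeasurable_pairSum hZ n).sqrt)

variable [IsProbabilityMeasure P] [IsProbabilityMeasure H]

/-- Asymptotic normality of the sample Gini correlation: by the delta method its scaled error is
that of the pair average of `corrKernel` up to `o_P(1)`. -/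
lemma tendstoInDistribution_sampleGiniCorr (hH : MemLp (fun z : ℝ × ℝ ↦ z) 2 H)
    (h1 : 0 < giniT₁ H) (h3 : 0 < giniT₃ H) (hlaw : ∀ i, HasLaw (Z i) H P)
    (hindep : iIndepFun Z P) :
    TendstoInDistribution
      (fun (n : ℕ) ω ↦ Real.sqrt n * (sampleGiniCorr n (fun i ↦ Z i ω) - giniCorr H))
      atTop (id : ℝ → ℝ) (fun _ ↦ P) (gaussianReal 0 (giniAsympVar H).toNNReal) := by
  have hH1 : Integrable (fun z : ℝ × ℝ ↦ z) H := hH.integrable one_le_two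
  have hb {k : ℝ × ℝ → ℝ} (hk : IsPairKernel k) :=
    isBoundedInProbability_of_tendstoInDistribution
      (hk.tendstoInDistribution_pairMean hH hlaw hindep)
  have hbdd : IsBoundedInProbability P (fun n ω ↦
      Real.sqrt n • (sampleGiniCov n (fun i ↦ Z i ω) - giniCov H)) := by
    have := (hb isPairKernel_giniKernel₁).prodMk
      ((hb isPairKernel_giniKernel₂).prodMk (hb isPairKernel_giniKernel₃))
    rw [← giniT₁_eq_kernelMean hH1, ← giniT₂_eq_kernelMean hH1, ← giniT₃_eq_kernelMean hH1] at this
    exact this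
  have hrem := tendstoInMeasure_delta_remainder
    (hasFDerivAt_corrOfCov (t := giniCov H) h1 h3) hbdd
  have hlin := (isPairKernel_corrKernel H).tendstoInDistribution_pairMean hH hlaw hindep
  rw [giniAsympVar, influenceFunction_giniCorr hH1 h1 h3]
  refine tendstoInDistribution_of_tendstoInMeasure_sub _ _ hlin (hrem.congr_left fun n ↦
    ae_of_all _ fun ω ↦ ?_) fun n ↦ ((aemeasurable_sampleGiniCorr
      (fun i ↦ (hlaw i).aemeasurable) n).sub_const _).const_mul _
  have hpm : pairMean (corrKernel H) n (fun i ↦ Z i ω) =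
      corrDeriv (giniCov H) (sampleGiniCov n (fun i ↦ Z i ω)) := by
    change pairMean (fun d ↦ _ * giniKernel₁ d + _ * giniKernel₂ d + _ * giniKernel₃ d) n _ = _
    rw [pairMean_add, pairMean_add, pairMean_const_mul, pairMean_const_mul, pairMean_const_mul]
    rfl
  simp only [Pi.sub_apply]
  rw [hpm, kernelMean_corrKernel hH1, map_sub, sampleGiniCorr_eq]
  change _ = Real.sqrt n * (_ - corrOfCov (giniCov H)) - _
  ring

end Sample

/-! ### Consistency, normality and the variance formulas -/

theorem theorem4 {Ω : Type*} [MeasurableSpace Ω] (P : Measure Ω) [IsProbabilityMeasure P]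
    (H : Measure (ℝ × ℝ)) [IsProbabilityMeasure H]
    -- finite second moment
    (hX : MemLp (fun z : ℝ × ℝ ↦ z.1) 2 H) (hY : MemLp (fun z : ℝ × ℝ ↦ z.2) 2 H)
    -- non-degenerate marginals
    (hX' : ∀ c : ℝ, ¬ ∀ᵐ z ∂H, z.1 = c) (hY' : ∀ c : ℝ, ¬ ∀ᵐ z ∂H, z.2 = c)
    -- i.i.d. sample from `H`
    (Z : ℕ → Ω → ℝ × ℝ) (hlaw : ∀ i, HasLaw (Z i) H P) (hindep : iIndepFun Z P) :
    -- the estimator is asymptotically unbiased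
    (∀ n, Integrable (fun ω ↦ sampleGiniCorr n (fun i ↦ Z i ω)) P) ∧
    Tendsto (fun n : ℕ ↦ ∫ ω, sampleGiniCorr n (fun i ↦ Z i ω) ∂P) atTop (𝓝 (giniCorr H)) ∧
    -- the estimator is root-n-consistent
    IsRootNConsistent P (fun n ω ↦ sampleGiniCorr n (fun i ↦ Z i ω)) (giniCorr H) ∧
    -- the influence functions exist and are square integrable
    (HasInfluenceFunction giniT₁ H ∧ HasInfluenceFunction giniT₂ H ∧
      HasInfluenceFunction giniT₃ H ∧ HasInfluenceFunction giniCorr H) ∧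
    (MemLp (giniL₁ H) 2 H ∧ MemLp (giniL₂ H) 2 H ∧ MemLp (giniL₃ H) 2 H ∧
      MemLp (influenceFunction giniCorr H) 2 H) ∧
    -- asymptotic normality
    TendstoInDistribution
      (fun (n : ℕ) ω ↦ Real.sqrt n * (sampleGiniCorr n (fun i ↦ Z i ω) - giniCorr H))
      atTop (id : ℝ → ℝ) (fun _ ↦ P) (gaussianReal 0 (giniAsympVar H).toNNReal) ∧
    -- the variance through the `Lᵢ` and `Tᵢ`; here `0 < T₁` and `0 < T₃`, while `T₂` may vanish
    0 < giniT₁ H ∧ 0 < giniT₃ H ∧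
    (giniT₂ H ≠ 0 →
      giniAsympVar H = (giniCorr H) ^ 2 / 4 *
        (1 / (giniT₁ H) ^ 2 * (∫ z, (giniL₁ H z) ^ 2 ∂H)
          + 4 / (giniT₂ H) ^ 2 * (∫ z, (giniL₂ H z) ^ 2 ∂H)
          + 1 / (giniT₃ H) ^ 2 * (∫ z, (giniL₃ H z) ^ 2 ∂H)
          - 4 / (giniT₁ H * giniT₂ H) * (∫ z, giniL₁ H z * giniL₂ H z ∂H)
          + 2 / (giniT₁ H * giniT₃ H) * (∫ z, giniL₁ H z * giniL₃ H z ∂H)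
          - 4 / (giniT₂ H * giniT₃ H) * (∫ z, giniL₂ H z * giniL₃ H z ∂H))) ∧
    (giniT₂ H = 0 →
      giniAsympVar H = 1 / (giniT₁ H * giniT₃ H) * (∫ z, (giniL₂ H z) ^ 2 ∂H)) := by
  have hH : MemLp (fun z : ℝ × ℝ ↦ z) 2 H :=
    (hX.norm.add hY.norm).of_le measurable_id.aestronglyMeasurable (ae_of_all _ fun z ↦
      (max_le_add_of_nonneg (norm_nonneg z.1) (norm_nonneg z.2)).trans (le_abs_self _))
  have hH1 : Integrable (fun z : ℝ × ℝ ↦ z) H := hH.integrable one_le_two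
  have hT1 : 0 < giniT₁ H := giniT₁_pos hH1 hX'
  have hT3 : 0 < giniT₃ H := giniT₃_pos hH1 hY'
  have hmeas (n : ℕ) : AEStronglyMeasurable (fun ω ↦ sampleGiniCorr n (fun i ↦ Z i ω)) P :=
    (aemeasurable_sampleGiniCorr (fun i ↦ (hlaw i).aemeasurable) n).aestronglyMeasurable
  have hnormal := tendstoInDistribution_sampleGiniCorr hH hT1 hT3 hlaw hindep
  have hbdd := isBoundedInProbability_of_tendstoInDistribution hnormal
  have hL1 : MemLp (giniL₁ H) 2 H := by
    rw [giniL₁_eq hH1]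
    exact isPairKernel_giniKernel₁.memLp_influence hH
  have hL2 : MemLp (giniL₂ H) 2 H := by
    rw [giniL₂_eq hH1]
    exact isPairKernel_giniKernel₂.memLp_influence hH
  have hL3 : MemLp (giniL₃ H) 2 H := by
    rw [giniL₃_eq hH1]
    exact isPairKernel_giniKernel₃.memLp_influence hH
  have hIF (z : ℝ × ℝ) : influenceFunction giniCorr H z =
      -(giniCorr H / (2 * giniT₁ H)) * giniL₁ H z +
        1 / (Real.sqrt (giniT₁ H) * Real.sqrt (giniT₃ H)) * giniL₂ H z +
        -(giniCorr H / (2 * giniT₃ H)) * giniL₃ H z := by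
    rw [influenceFunction_giniCorr hH1 hT1 hT3, kernelInfluence_corrKernel hH1, giniL₁_eq hH1,
      giniL₂_eq hH1, giniL₃_eq hH1]
    rfl
  have hvar := integral_sq_linear_combination hL1 hL2 hL3 (-(giniCorr H / (2 * giniT₁ H)))
    (1 / (Real.sqrt (giniT₁ H) * Real.sqrt (giniT₃ H))) (-(giniCorr H / (2 * giniT₃ H)))
  simp only [← hIF] at hvar
  change giniAsympVar H = _ at hvar
  have hunbiased := tendsto_integral_of_tendstoInMeasure_of_bounded hmeas
    (fun n ω ↦ abs_sampleGiniCorr_le_one n _)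
    (tendstoInMeasure_of_isBoundedInProbability_sqrt_mul hbdd)
  rw [integral_const, probReal_univ, one_smul] at hunbiased
  refine ⟨fun n ↦ Integrable.of_bound (hmeas n) 1
      (ae_of_all _ fun ω ↦ abs_sampleGiniCorr_le_one n _), hunbiased, fun ε hε ↦ ?_,
    ⟨fun z ↦ ⟨_, tendsto_influenceQuotient_giniT₁ hH1 z⟩,
      fun z ↦ ⟨_, tendsto_influenceQuotient_giniT₂ hH1 z⟩,
      fun z ↦ ⟨_, tendsto_influenceQuotient_giniT₃ hH1 z⟩,
      fun z ↦ ⟨_, tendsto_influenceQuotient_giniCorr hH1 hT1 hT3 z⟩⟩,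
    ⟨hL1, hL2, hL3, ?_⟩, hnormal, hT1, hT3, fun hT2 ↦ ?_, fun hT2 ↦ ?_⟩
  · obtain ⟨M, hM⟩ := hbdd ε hε
    refine ⟨M, fun n ↦ (le_of_eq ?_).trans (hM n)⟩
    simp only [norm_mul, Real.norm_eq_abs, abs_of_nonneg (Real.sqrt_nonneg _)]
  · rw [influenceFunction_giniCorr hH1 hT1 hT3]
    exact (isPairKernel_corrKernel H).memLp_influence hH
  · -- For `T₂ ≠ 0` the coefficient of `L₂` is the logarithmic derivative `ρ_g / T₂`.
    have hb : 1 / (Real.sqrt (giniT₁ H) * Real.sqrt (giniT₃ H)) = giniCorr H / giniT₂ H := by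
      rw [giniCorr]
      field_simp
    rw [hvar, hb]
    field_simp
    ring
  · have hρ : giniCorr H = 0 := by rw [giniCorr, hT2, zero_div]
    rw [hvar, hρ, div_pow, mul_pow, Real.sq_sqrt hT1.le, Real.sq_sqrt hT3.le]
    simp
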